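/- **Setting.** Let $N\ge 1$ agents $A_1,\dots,A_N$ produce output signals $x_n:\mathbb R_{\ge 0}\to\mathbb R$ (functions of local time) that are right-continuous with finite left limits, and let $\varepsilon>0$ be the maximal clock skew. A *root* of $x_n$ is a time $t$ with $x_n(t)=0$, or a time $t>0$ with $\operatorname{sgn}x_n(t)\ne\operatorname{sgn}\lim_{s\to t^-}x_n(s)$. It is a *left root* if $x_n<0$ on $[t-\delta,t)$ for some $0<\delta\le t$, and a *right root* if $x_n<0$ on $(t,t+\delta]$ for some $\delta>0$. Each $x_n$ is assumed to have infinitely many left or right roots, but only finitely many in any bounded interval. Let $E=\{e_n^t: n\le N,\ t\ge 0\}$ and let *happened-before* be the smallest transitive relation on $E$ with $e_n^t\to e_n^{t'}$ for $t<t'$ and $e_n^t\to e_m^{t'}$ for $t+\varepsilon\le t'$. A *cut* is a set $C\subsetneq E$ that is closed under predecessors and contains an event of every agent; its *frontier* is $(t_n)_n$ with $t_n=\sup\{t: e_n^t\in C\}$. It is a *satcut* if $x_n(t_n)\ge 0$ for all $n$; $S_E$ is the set of satcuts. For $\alpha>0$, $C\mp\alpha$ is the set of cuts with frontier $(t_n\mp\delta_n)_n$,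 $0\le\delta_n\le\alpha$, not all $\delta_n$ zero. $C$ is a *leftmost satcut* if $C\in S_E$ and $(C-\alpha)\cap S_E=\emptyset$ for some $\alpha>0$. $C$ is a *rightmost cut* if, for some $\alpha>0$, $(C+\alpha)\cap S_E=\emptyset$ and $C-\alpha\subseteq S_E$, where $C-\alpha\neq\emptyset$ or $C\in S_E$. *Extremal cuts* are the leftmost satcuts and the rightmost cuts. **The detector.** It runs asynchronously with FIFO lossless channels and arbitrary finite message delays; every action that stays enabled is eventually taken. *Abstractor of $A_n$.* It finds the left and right roots of $x_n$ in increasing order, puts them into a buffer, and sends each right root to all other agents. On receiving a right root $e_m^r$ it puts $e_n^{r+\varepsilon}$ into the buffer. It forwards its oldest buffered event $e_n^s$ to the slicer of $A_n$ once it has found all left and right roots of $x_n$ up to $s$ and has received from every other agent a right root of time at least $s-\varepsilon$. *Slicers.* The slicer of $A_n$ stores the initial event $e_n^0$, the events forwarded to it, and the events it creates. The vector clock of $e_n^t$ has $n$-th entry $t$ and all other entries $\max(t-\varepsilon,0)$. A frontier is *consistent* if it dominates, entry by entry, the vector clocks of all its events. A discrete event $e_n^t$ is *satisfying* if $x_n(t)\ge0$,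 or if $t$ is a right root immediately preceded by an interval of nonnegative values. Token $T_n$ completes $e_n^0$ and then, in order, the events forwarded to the slicer of $A_n$. It carries a frontier, initially $(0,\dots,0)$. To start on an event $e_n^t$, it raises the $n$-th entry of its frontier to at least $t$. If the frontier is inconsistent, $T_n$ goes to some agent $A_m$ whose entry is smaller than that required by the vector clocks, and incorporates the event $e_m^s$ of the required time $s$ (of the form $t'-\varepsilon$, with $e_k^{t'}$ on the frontier). If the slicer of $A_m$ does not store this event, it creates it as soon as it has received a later event from its abstractor. If the frontier is consistent but not satisfying, $T_n$ goes to some $A_m$ whose frontier event is not satisfying, and replaces that event by the next one stored by the slicer of $A_m$, waiting for it if necessary. If the frontier is consistent and satisfying, it is output and $T_n$ proceeds to the next event of $A_n$. The cuts *returned* are the finite nonempty joins (entrywise maxima) of the frontiers output by the tokens. **Theorem.** In every run of the detector: 1. every returned frontier is a satcut of the discrete signal: its entries are events stored by the slicers, it is consistent, and all its events are satisfying; 2. every consistent frontier that consists of satisfying events among the initial events and those received by the slicers from the abstractors is eventually returned; 3. the frontier of every extremal cut of the continuous-time signal is eventually returned. -/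

import Mathlib

open Filter Set
open scoped NNReal Topology

namespace PredDetect

/-! ### Signals and roots

Local time is `ℝ≥0`; the output signal of an agent is a function `ℝ≥0 → ℝ`. -/

/-- Output signal: right-continuous with finite left limits.
(At `t = 0` the second clause is void, as `𝓝[<] 0 = ⊥` in `ℝ≥0`.) -/
def IsOutputSignal (x : ℝ≥0 → ℝ) : Prop :=
  ∀ t, ContinuousWithinAt x (Ici t) t ∧ ∃ l : ℝ, Tendsto x (𝓝[<] t) (𝓝 l)

/-- Root at local time `t`: a zero of the signal, or a discontinuity at which it changes sign. -/
def IsRoot (x : ℝ≥0 → ℝ) (t : ℝ≥0) : Prop :=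
  x t = 0 ∨
    (0 < t ∧ ∃ l : ℝ, Tendsto x (𝓝[<] t) (𝓝 l) ∧ SignType.sign (x t) ≠ SignType.sign l)

/-- Left root: a root preceded by negative values. -/
def IsLeftRoot (x : ℝ≥0 → ℝ) (t : ℝ≥0) : Prop :=
  IsRoot x t ∧ ∃ δ : ℝ≥0, 0 < δ ∧ δ ≤ t ∧ ∀ α, 0 < α → α ≤ δ → x (t - α) < 0

/-- Right root: a root followed by negative values. -/
def IsRightRoot (x : ℝ≥0 → ℝ) (t : ℝ≥0) : Prop :=
  IsRoot x t ∧ ∃ δ : ℝ≥0, 0 < δ ∧ ∀ α, 0 < α → α ≤ δ → x (t + α) < 0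

/-- The left and the right roots of a signal. -/
def roots (x : ℝ≥0 → ℝ) : Set ℝ≥0 := {t | IsLeftRoot x t ∨ IsRightRoot x t}

/-- Starvation-freedom and non-Zeno: infinitely many roots, finitely many in bounded time. -/
def StarvationFreeNonZeno (x : ℝ≥0 → ℝ) : Prop :=
  (roots x).Infinite ∧ ∀ T : ℝ≥0, (roots x ∩ Iic T).Finite

/-! ### Happened-before, consistent cuts, extremal cuts -/

/-- `(n, t)` is the event of agent `n` at its local time `t`. -/
abbrev Event (N : ℕ) := Fin N × ℝ≥0

/-- The happened-before relation for maximal clock skew `ε`. -/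
inductive HB {N : ℕ} (ε : ℝ≥0) : Event N → Event N → Prop
  | loc (n : Fin N) (t t' : ℝ≥0) : t < t' → HB ε (n, t) (n, t')
  | skew (n m : Fin N) (t t' : ℝ≥0) : t + ε ≤ t' → HB ε (n, t) (m, t')
  | trans (e f g : Event N) : HB ε e f → HB ε f g → HB ε e g

/-- Consistent cut: closed under happened-before, with at least one event of every agent, and
different from the set of all events. -/
def IsCut {N : ℕ} (ε : ℝ≥0) (C : Set (Event N)) : Prop :=
  (∀ e f, e ∈ C → HB ε f e → f ∈ C) ∧ (∀ n, ∃ t, (n, t) ∈ C) ∧ C ≠ univ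

/-- The frontier of a cut, given by its local times. -/
noncomputable def front {N : ℕ} (C : Set (Event N)) : Fin N → ℝ≥0 :=
  fun n => sSup {t | (n, t) ∈ C}

/-- `satcuts ε x` is the set `S_E` of consistent cuts that satisfy `⋀ n, x n ≥ 0`. -/
def satcuts {N : ℕ} (ε : ℝ≥0) (x : Fin N → ℝ≥0 → ℝ) : Set (Set (Event N)) :=
  {C | IsCut ε C ∧ ∀ n, 0 ≤ x n (front C n)}

/-- `C - α`. -/
def shiftLeft {N : ℕ} (ε : ℝ≥0) (C : Set (Event N)) (α : ℝ≥0) : Set (Set (Event N)) :=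
  {C' | IsCut ε C' ∧ ∃ δ : Fin N → ℝ≥0, (∀ n, δ n ≤ α) ∧ (∃ n, 0 < δ n) ∧
    ∀ n, front C' n + δ n = front C n}

/-- `C + α`. -/
def shiftRight {N : ℕ} (ε : ℝ≥0) (C : Set (Event N)) (α : ℝ≥0) : Set (Set (Event N)) :=
  {C' | IsCut ε C' ∧ ∃ δ : Fin N → ℝ≥0, (∀ n, δ n ≤ α) ∧ (∃ n, 0 < δ n) ∧
    ∀ n, front C' n = front C n + δ n}

def IsLeftmostSatcut {N : ℕ} (ε : ℝ≥0) (x : Fin N → ℝ≥0 → ℝ) (C : Set (Event N)) : Prop :=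
  C ∈ satcuts ε x ∧ ∃ α : ℝ≥0, 0 < α ∧ Disjoint (shiftLeft ε C α) (satcuts ε x)

/-- Rightmost cut, not necessarily satisfying. The last clause only concerns the cut whose frontier
is at local time `0` on all agents, the only one that cannot be moved to the left: such a cut has to
be satisfying. -/
def IsRightmostCut {N : ℕ} (ε : ℝ≥0) (x : Fin N → ℝ≥0 → ℝ) (C : Set (Event N)) : Prop :=
  IsCut ε C ∧ ∃ α : ℝ≥0, 0 < α ∧ Disjoint (shiftRight ε C α) (satcuts ε x) ∧
    shiftLeft ε C α ⊆ satcuts ε x ∧ (C ∈ satcuts ε x ∨ (shiftLeft ε C α).Nonempty)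

def IsExtremalCut {N : ℕ} (ε : ℝ≥0) (x : Fin N → ℝ≥0 → ℝ) (C : Set (Event N)) : Prop :=
  IsLeftmostSatcut ε x C ∨ IsRightmostCut ε x C

/-! ### Discrete events: physical vector clocks, consistency, satisfaction -/

/-- The physical vector clock of the event of agent `n` at time `t`: its own entry is `t`, every
other one is `t - ε`, or `0` if `t < ε` (the subtraction of `ℝ≥0` is truncated). -/
noncomputable def pvc {N : ℕ} (ε : ℝ≥0) (n : Fin N) (t : ℝ≥0) : Fin N → ℝ≥0 :=
  fun i => if i = n then t else t - ε

/-- The dependency vector of a frontier `c`: the join of the vector clocks of its events. -/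
noncomputable def depend {N : ℕ} (ε : ℝ≥0) (c : Fin N → ℝ≥0) : Fin N → ℝ≥0 :=
  Finset.univ.sup fun k => pvc ε k (c k)

/-- The slicers' consistency test. -/
def Consistent {N : ℕ} (ε : ℝ≥0) (c : Fin N → ℝ≥0) : Prop :=
  ∀ m, depend ε c m ≤ c m

/-- An event of the discrete signal satisfies its conjunct if the signal is nonnegative there, or if
it is a right root that ends an interval of nonnegative values. (The second case adds something only
if the signal jumps to a negative value at that root.) -/
def DSat (x : ℝ≥0 → ℝ) (t : ℝ≥0) : Prop :=
  0 ≤ x t ∨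
    (IsRightRoot x t ∧ ∃ δ : ℝ≥0, 0 < δ ∧ δ ≤ t ∧ ∀ α, 0 < α → α ≤ δ → 0 ≤ x (t - α))

/-! ### The detector as an asynchronous transition system -/

/-- The place where a token is, together with the event that it waits for there. -/
inductive Target (N : ℕ) : Type
  /-- with its parent agent, for the next event of the parent's abstractor -/
  | home : Target N
  /-- on agent `m`, for the event of local time `s` -/
  | dep (m : Fin N) (s : ℝ≥0) : Target N
  /-- on agent `m`, for the event that follows the forbidden event of local time `s` -/
  | next (m : Fin N) (s : ℝ≥0) : Target N

/-- A token: the (local time of the) event of its parent that it is completing, the frontier of its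
current cut, and its target. -/
structure Token (N : ℕ) where
  event : ℝ≥0
  cut : Fin N → ℝ≥0
  target : Target N

/-- Global state of the detector. Events of agent `n` are given by their local times. -/
structure State (N : ℕ) where
  /-- roots of its own signal that agent `n` has found -/
  found : Fin N → Set ℝ≥0
  /-- `chan m n`: FIFO channel from agent `m` to agent `n`, with the right roots of `m` on their
  way to `n`, oldest first -/
  chan : Fin N → Fin N → List ℝ≥0
  /-- `heard n m`: right roots of agent `m` about which agent `n` has received a message -/
  heard : Fin N → Fin N → Set ℝ≥0
  /-- local buffer of the abstractor of agent `n` -/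
  buffer : Fin N → Set ℝ≥0
  /-- events that the slicer of agent `n` has received from the abstractor -/
  recv : Fin N → Set ℝ≥0
  /-- events stored by the slicer of agent `n`: those received and those it created -/
  log : Fin N → Set ℝ≥0
  /-- the tokens, one for each parent agent -/
  token : Fin N → Token N
  /-- frontiers of the cuts that have been output -/
  out : Set (Fin N → ℝ≥0)

/-- Initially every slicer knows just the initial event of its agent, at local time `0`, and every
token is to complete the initial event of its parent. -/
def State.init (N : ℕ) : State N where
  found := fun _ => ∅
  chan := fun _ _ => []
  heard := fun _ _ => ∅
  buffer := fun _ => ∅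
  recv := fun _ => {0}
  log := fun _ => {0}
  token := fun n => ⟨0, fun _ => 0, Target.dep n 0⟩
  out := ∅

/-- The possible next targets of a token whose cut has the frontier `c`. An inconsistent cut: some
agent `m` whose frontier event is too old, and there the event that the vector clocks require. A
consistent cut that does not satisfy the predicate: some agent `m` whose frontier event violates it,
and there the event that follows. Otherwise the token has completed its event and goes home. -/
def Assess {N : ℕ} (ε : ℝ≥0) (x : Fin N → ℝ≥0 → ℝ) (c : Fin N → ℝ≥0) : Target N → Prop
  | .home => Consistent ε c ∧ ∀ m, DSat (x m) (c m)
  | .dep m s => c m < depend ε c m ∧ s = depend ε c m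
  | .next m s => Consistent ε c ∧ ¬ DSat (x m) (c m) ∧ s = c m

/-- `Arrives st n m s ev`: in state `st` the target of token `n` is available; it is the event of
agent `m` of local time `s`, and `ev` is then the event that the token is completing.
A required event (`dep`) that the slicer has not stored is available once the slicer has received
a later event from the abstractor: the slicer then creates it. -/
def Arrives {N : ℕ} (st : State N) (n m : Fin N) (s ev : ℝ≥0) : Prop :=
  match (st.token n).target with
  | .home => m = n ∧ IsLeast {t ∈ st.recv n | (st.token n).event < t} s ∧ ev = s
  | .dep m' s' => m = m' ∧ s = s' ∧ ev = (st.token n).event ∧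
      (s ∈ st.log m ∨ ∃ t ∈ st.recv m, s < t)
  | .next m' s' => m = m' ∧ IsLeast {t ∈ st.log m | s' < t} s ∧ ev = (st.token n).event

/-- The frontier after token `n` has incorporated the event of agent `m` of local time `s`. -/
noncomputable def State.newCut {N : ℕ} (st : State N) (n m : Fin N) (s : ℝ≥0) : Fin N → ℝ≥0 :=
  Function.update (st.token n).cut m ((st.token n).cut m ⊔ s)

/-- The local actions of the detector. -/
inductive Action (N : ℕ) : Type
  | find (n : Fin N) : Action N
  | hear (m n : Fin N) : Action N
  | forward (n : Fin N) : Action N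
  | move (n : Fin N) : Action N

open Classical in
/-- One step of the detector. -/
inductive Step {N : ℕ} (ε : ℝ≥0) (x : Fin N → ℝ≥0 → ℝ) : Action N → State N → State N → Prop
  /-- Abstractor `n` finds the next root `r` of its signal, adds it to its buffer and, if it is a
  right root, sends it to all other agents. -/
  | find (st : State N) (n : Fin N) (r : ℝ≥0) (hr : IsLeast (roots (x n) \ st.found n) r) :
      Step ε x (.find n) st
        { st with
          found := Function.update st.found n (insert r (st.found n))
          buffer := Function.update st.buffer n (insert r (st.buffer n))
          chan := fun k m =>
            if k = n ∧ m ≠ n ∧ IsRightRoot (x n) r then st.chan k m ++ [r] else st.chan k m }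
  /-- Abstractor `n` receives the right root `r` of agent `m` and creates its own event of local
  time `r + ε`. -/
  | hear (st : State N) (m n : Fin N) (r : ℝ≥0) (l : List ℝ≥0) (hl : st.chan m n = r :: l) :
      Step ε x (.hear m n) st
        { st with
          chan := fun k j => if k = m ∧ j = n then l else st.chan k j
          heard := fun j k => if j = n ∧ k = m then insert r (st.heard j k) else st.heard j k
          buffer := Function.update st.buffer n (insert (r + ε) (st.buffer n)) }
  /-- Abstractor `n` forwards the oldest event `s` of its buffer to its slicer, provided that this
  event is ready: the agent has found all roots of its own signal up to `s`, and from every other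
  agent it has received a right root of time at least `s - ε`. -/
  | forward (st : State N) (n : Fin N) (s : ℝ≥0) (hs : IsLeast (st.buffer n) s)
      (hown : ∀ r ∈ roots (x n), r ≤ s → r ∈ st.found n)
      (hother : ∀ k, k ≠ n → ∃ r ∈ st.heard n k, s ≤ r + ε) :
      Step ε x (.forward n) st
        { st with
          buffer := Function.update st.buffer n (st.buffer n \ {s})
          recv := Function.update st.recv n (insert s (st.recv n))
          log := Function.update st.log n (insert s (st.log n)) }
  /-- Token `n` incorporates its target, which the slicer there creates if it is missing; the token
  is assessed and gets a new target. If it has completed its event, its cut is output. -/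
  | move (st : State N) (n m : Fin N) (s ev : ℝ≥0) (tgt : Target N)
      (harr : Arrives st n m s ev) (htgt : Assess ε x (st.newCut n m s) tgt) :
      Step ε x (.move n) st
        { st with
          log := Function.update st.log m (insert s (st.log m))
          token := Function.update st.token n ⟨ev, st.newCut n m s, tgt⟩
          out := {c | c ∈ st.out ∨ (tgt = .home ∧ c = st.newCut n m s)} }

/-- A run of the detector: an infinite sequence of steps from the initial state in which no action
remains enabled forever without being taken. Message delays are otherwise arbitrary. -/
structure IsRun {N : ℕ} (ε : ℝ≥0) (x : Fin N → ℝ≥0 → ℝ) (σ : ℕ → State N) : Prop where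
  init : σ 0 = State.init N
  step : ∀ i, ∃ a, Step ε x a (σ i) (σ (i + 1))
  fair : ∀ (a : Action N) (i : ℕ), ∃ j, i ≤ j ∧
    ((¬ ∃ st, Step ε x a (σ j) st) ∨ Step ε x a (σ j) (σ (j + 1)))

/-- `c` is the frontier of a satcut of the discrete signal that the slicers hold in state `st`. -/
def IsDiscreteSatcut {N : ℕ} (ε : ℝ≥0) (x : Fin N → ℝ≥0 → ℝ) (st : State N)
    (c : Fin N → ℝ≥0) : Prop :=
  (∀ m, c m ∈ st.log m) ∧ Consistent ε c ∧ ∀ m, DSat (x m) (c m)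

/-- The cuts returned up to state `st`: the finite non-empty joins of the cuts that were output. -/
def State.returned {N : ℕ} (st : State N) : Set (Fin N → ℝ≥0) :=
  supClosure st.out

end PredDetect

/-!
The proof rests on three facts about a run of the detector.

*The slicers receive initial segments of fixed event streams.* The abstractor of agent `n` can only
produce the roots of its own signal and the right roots of the others, delayed by `ε`; together with
time `0` these times form `stream ε x n`. Since the channels are FIFO and roots are found in
increasing order, the readiness test for forwarding an event guarantees that nothing earlier is
still to come (`AbstractorInv.mem_recv_of_ready`), so that the received events form an initial
segment of the stream. A falling signal has a right root, hence right roots are unbounded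
(`exists_isRightRoot_gt`), every readiness test succeeds in the end, and by fairness the whole
stream is received (`IsRun.eventually_recv`).

*A token does not overtake a satisfying consistent frontier.* Let `c` be such a frontier. While
token `n` works on events up to `c n`, its cut stays below `c` (`Guarded`): required events are
bounded by the dependency vector of `c`, and between a violating event and the satisfying event
`c m` there is a root, which the slicer stores before it stores anything later. So, if `c n` belongs
to the stream, the only way for token `n` to get to an event after `c n` is to output a cut that is
below `c` and agrees with it at `n`.

*Tokens never get stuck in bounded time* (`IsRun.exists_lt_cut`). Every token moves infinitely
often, and each of its moves increases its event or its cut. Slicers also create events, possibly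
from created events, so it is not immediate that only finitely many events are stored below a bound
`T`. But if `T` bounds the cuts of all bounded tokens, then after the other tokens have passed
`T + ε`, events up to `T` are only created by bounded tokens, each one `ε` before a stored event, and
going back by multiples of `ε` from a finite set of nonnegative times yields a finite set. Within
this set a bounded token cannot progress forever.

Consequently a satisfying consistent frontier is returned, as the join of outputs, as soon as each
of its entries is in the stream or forced by such an entry (`IsRun.exists_mem_returned`). For
extremal cuts this is seen by moving the frontier. An entry of a leftmost satcut that cannot be
moved to the left alone is forced by an entry that can, and the latter is a left root. In a
rightmost satisfying cut, an entry is a right root or is blocked by one, `ε` earlier. If a rightmost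
cut violates the predicate at `m`, then `m` is at a right root where the signal jumps, and every
other entry is forced by this root, since otherwise it could be moved to the left without `m`.
-/

namespace PredDetect

/-! ### Roots of a signal -/

section Signal

variable {x : ℝ≥0 → ℝ} {s t : ℝ≥0}

lemma eventually_nhdsLT_of_forall_sub {P : ℝ≥0 → Prop} {δ : ℝ≥0} (hδ : 0 < δ) (hδt : δ ≤ t)
    (h : ∀ α, 0 < α → α ≤ δ → P (t - α)) : ∀ᶠ v in 𝓝[<] t, P v := by
  have h1 : t - δ < t := tsub_lt_self (hδ.trans_le hδt) hδ
  filter_upwards [Ioo_mem_nhdsLT h1] with v hv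
  have h2 := h (t - v) (tsub_pos_of_lt hv.2) (tsub_le_iff_left.2 (tsub_le_iff_right.1 hv.1.le))
  rwa [tsub_tsub_cancel_of_le hv.2.le] at h2

lemma neBot_nhdsLT_of_pos (ht : 0 < t) : (𝓝[<] t).NeBot :=
  nhdsLT_neBot_of_exists_lt ⟨0, ht⟩

lemma IsOutputSignal.exists_lt_forall_neg (hx : IsOutputSignal x) (h : x t < 0) :
    ∃ w, t < w ∧ ∀ v, t ≤ v → v < w → x v < 0 := by
  have h1 : ∀ᶠ v in 𝓝[≥] t, x v < 0 := (hx t).1.eventually_lt_const h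
  obtain ⟨w, hw, h2⟩ := (mem_nhdsGE_iff_exists_Ico_subset' (lt_add_one t)).1 h1
  exact ⟨w, hw, fun v h3 h4 => h2 ⟨h3, h4⟩⟩

lemma IsOutputSignal.exists_forall_add_neg (hx : IsOutputSignal x) (h : x t < 0) :
    ∃ δ : ℝ≥0, 0 < δ ∧ ∀ α, 0 < α → α ≤ δ → x (t + α) < 0 := by
  obtain ⟨w, hw, h2⟩ := hx.exists_lt_forall_neg h
  refine ⟨(w - t) / 2, half_pos (tsub_pos_of_lt hw), fun α _ h4 => h2 _ le_self_add ?_⟩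
  have h5 : α < w - t := h4.trans_lt (half_lt_self (tsub_pos_of_lt hw))
  rw [add_comm]
  exact lt_tsub_iff_right.1 h5

lemma IsOutputSignal.isLeftRoot (hx : IsOutputSignal x) {δ : ℝ≥0} (hδ : 0 < δ) (hδt : δ ≤ t)
    (h : ∀ α, 0 < α → α ≤ δ → x (t - α) < 0) (ht : 0 ≤ x t) : IsLeftRoot x t := by
  refine ⟨?_, δ, hδ, hδt, h⟩
  rcases ht.eq_or_lt with h0 | h0
  · exact Or.inl h0.symm
  have hpos := hδ.trans_le hδt
  obtain ⟨l, hl⟩ := (hx t).2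
  refine Or.inr ⟨hpos, l, hl, ?_⟩
  have := neBot_nhdsLT_of_pos hpos
  have hl0 : l ≤ 0 := le_of_tendsto hl
    ((eventually_nhdsLT_of_forall_sub (P := fun v => x v < 0) hδ hδt h).mono fun _ => le_of_lt)
  rw [sign_pos h0]
  intro h1
  exact absurd (sign_eq_one_iff.1 h1.symm) hl0.not_gt

/-- A negative event with nonnegative values arbitrarily close before it is a right root: the left
limit is nonnegative, so that the sign changes, and right-continuity keeps the signal negative. -/
lemma IsOutputSignal.isRightRoot_of_neg (hx : IsOutputSignal x) (ht0 : 0 < t)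
    (h : ∃ᶠ v in 𝓝[<] t, 0 ≤ x v) (ht : x t < 0) : IsRightRoot x t := by
  obtain ⟨l, hl⟩ := (hx t).2
  refine ⟨Or.inr ⟨ht0, l, hl, ?_⟩, hx.exists_forall_add_neg ht⟩
  have hl0 : 0 ≤ l := ge_of_tendsto_of_frequently hl h
  rw [sign_neg ht]
  intro h1
  exact absurd (sign_eq_neg_one_iff.1 h1.symm) hl0.not_gt

lemma IsOutputSignal.isRightRoot_of_nonneg (hx : IsOutputSignal x) {δ : ℝ≥0} (hδ : 0 < δ)
    (h : ∀ α, 0 < α → α ≤ δ → x (t + α) < 0) (ht : 0 ≤ x t) : IsRightRoot x t := by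
  refine ⟨Or.inl (le_antisymm ?_ ht), δ, hδ, h⟩
  have h1 : Tendsto x (𝓝[>] t) (𝓝 (x t)) :=
    (hx t).1.mono_left (nhdsWithin_mono _ Ioi_subset_Ici_self)
  have : (𝓝[>] t).NeBot := nhdsGT_neBot_of_exists_gt ⟨t + 1, lt_add_one t⟩
  refine le_of_tendsto h1 ?_
  filter_upwards [Ioo_mem_nhdsGT (lt_add_of_pos_right t hδ)] with v hv
  have h2 := h (v - t) (tsub_pos_of_lt hv.1) (tsub_le_iff_left.2 hv.2.le)
  rw [add_tsub_cancel_of_le hv.1.le] at h2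
  exact h2.le

/-- A signal that rises from a negative to a nonnegative value has a left root in between: the
first time at which it is nonnegative again. -/
lemma IsOutputSignal.exists_isLeftRoot (hx : IsOutputSignal x) (hst : s < t) (hs : x s < 0)
    (ht : 0 ≤ x t) : ∃ u, s < u ∧ u ≤ t ∧ IsLeftRoot x u := by
  set S : Set ℝ≥0 := {v | s < v ∧ 0 ≤ x v}
  have hS : BddBelow S := OrderBot.bddBelow S
  have hne : S.Nonempty := ⟨t, hst, ht⟩
  have hut : sInf S ≤ t := csInf_le hS ⟨hst, ht⟩
  have hsu : s ≤ sInf S := le_csInf hne fun v hv => hv.1.le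
  have hu : 0 ≤ x (sInf S) := by
    by_contra! h
    obtain ⟨w, hw, h2⟩ := hx.exists_lt_forall_neg h
    refine hw.not_ge (le_csInf hne fun v hv => ?_)
    by_contra! h3
    exact (h2 v (csInf_le hS hv) h3).not_ge hv.2
  have hsu' : s < sInf S := hsu.lt_of_ne fun h => hs.not_ge (h ▸ hu)
  refine ⟨sInf S, hsu', hut, hx.isLeftRoot (tsub_pos_of_lt hsu') tsub_le_self
    (fun α h1 h2 => ?_) hu⟩
  by_contra! h3
  have h4 : sInf S - α < sInf S := tsub_lt_self (hsu'.trans_le' zero_le) h1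
  have h6 : s ≤ sInf S - α := by
    rw [← tsub_tsub_cancel_of_le hsu]
    exact tsub_le_tsub_left h2 _
  rcases h6.eq_or_lt with h5 | h5
  · exact hs.not_ge (h5 ▸ h3)
  · exact h4.not_ge (csInf_le hS ⟨h5, h3⟩)

/-- A signal that falls from a nonnegative to a negative value has a right root in between: the
supremum of the times at which it is still nonnegative. -/
lemma IsOutputSignal.exists_isRightRoot (hx : IsOutputSignal x) (hst : s < t) (hs : 0 ≤ x s)
    (ht : x t < 0) : ∃ u, s ≤ u ∧ IsRightRoot x u := by
  set S : Set ℝ≥0 := {v | v ≤ t ∧ 0 ≤ x v}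
  have hS : BddAbove S := ⟨t, fun v hv => hv.1⟩
  have hsS : s ∈ S := ⟨hst.le, hs⟩
  have hsu : s ≤ sSup S := le_csSup hS hsS
  have hut : sSup S ≤ t := csSup_le ⟨s, hsS⟩ fun v hv => hv.1
  refine ⟨sSup S, hsu, ?_⟩
  rcases lt_or_ge (x (sSup S)) 0 with h | h
  · have hsu' : s < sSup S := hsu.lt_of_ne fun h' => h.not_ge (h' ▸ hs)
    refine hx.isRightRoot_of_neg (hsu'.trans_le' zero_le) ?_ h
    intro h1
    obtain ⟨w, hw, h2⟩ := (mem_nhdsLT_iff_exists_Ioo_subset' hsu').1 h1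
    obtain ⟨v, hv, hwv⟩ := exists_lt_of_lt_csSup ⟨s, hsS⟩ hw
    have hvu : v < sSup S := (le_csSup hS hv).lt_of_ne fun h' => h.not_ge (h' ▸ hv.2)
    exact h2 ⟨hwv, hvu⟩ hv.2
  · have hut' : sSup S < t := hut.lt_of_ne fun h' => ht.not_ge (h' ▸ h)
    refine hx.isRightRoot_of_nonneg (tsub_pos_of_lt hut') (fun α h1 h2 => ?_) h
    by_contra! h3
    have h4 : sSup S + α ∈ S := ⟨by
      rw [add_comm]; exact (le_tsub_iff_right hut).1 h2, h3⟩
    exact (lt_add_of_pos_right _ h1).not_ge (le_csSup hS h4)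

/-- Between an event that violates the predicate and a later one that satisfies it there is a
root. -/
lemma IsOutputSignal.exists_root_of_dSat (hx : IsOutputSignal x) (hst : s < t) (hs : ¬ DSat x s)
    (ht : DSat x t) : ∃ u ∈ roots x, s < u ∧ u ≤ t := by
  rcases ht with ht | ht
  · have hs' : x s < 0 := not_le.1 fun h => hs (Or.inl h)
    obtain ⟨u, h1, h2, h3⟩ := hx.exists_isLeftRoot hst hs' ht
    exact ⟨u, Or.inl h3, h1, h2⟩
  · exact ⟨t, Or.inr ht.1, hst, le_rfl⟩

lemma StarvationFreeNonZeno.exists_root_gt (h : StarvationFreeNonZeno x) (T : ℝ≥0) :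
    ∃ r ∈ roots x, T < r := by
  by_contra! h1
  exact h.1 ((h.2 T).subset fun r hr => ⟨hr, h1 r hr⟩)

/-- A left root is itself a right root, or the signal is nonnegative there and has to become
negative before the next left root; hence the right roots are unbounded as well. -/
lemma exists_isRightRoot_gt (hx : IsOutputSignal x) (h : StarvationFreeNonZeno x) (T : ℝ≥0) :
    ∃ r, IsRightRoot x r ∧ T < r := by
  obtain ⟨r, hr, hTr⟩ := h.exists_root_gt T
  rcases hr with hr | hr
  swap
  · exact ⟨r, hr, hTr⟩
  rcases lt_or_ge (x r) 0 with h0 | h0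
  · exact ⟨r, ⟨hr.1, hx.exists_forall_add_neg h0⟩, hTr⟩
  obtain ⟨q, hq, hrq⟩ := h.exists_root_gt r
  rcases hq with hq | hq
  swap
  · exact ⟨q, hq, hTr.trans hrq⟩
  obtain ⟨-, δ, hδ, hδq, h1⟩ := hq
  have := neBot_nhdsLT_of_pos (hδ.trans_le hδq)
  obtain ⟨v, hv, hrv⟩ := ((eventually_nhdsLT_of_forall_sub (P := fun v => x v < 0) hδ hδq h1).and
    (Ioo_mem_nhdsLT hrq)).exists
  obtain ⟨u, hu, hu'⟩ := hx.exists_isRightRoot hrv.1 h0 hv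
  exact ⟨u, hu', hTr.trans_le hu⟩

end Signal

/-! ### Frontiers and cuts -/

section Frontier

variable {N : ℕ} {ε : ℝ≥0} {c d : Fin N → ℝ≥0}

lemma depend_apply (ε : ℝ≥0) (c : Fin N → ℝ≥0) (m : Fin N) :
    depend ε c m = Finset.univ.sup fun k => pvc ε k (c k) m :=
  Finset.sup_apply _ _ _

lemma pvc_mono (k : Fin N) {s t : ℝ≥0} (h : s ≤ t) (m : Fin N) : pvc ε k s m ≤ pvc ε k t m := by
  unfold pvc
  split_ifs
  · exact h
  · exact tsub_le_tsub_right h ε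

lemma depend_mono (h : c ≤ d) (m : Fin N) : depend ε c m ≤ depend ε d m := by
  rw [depend_apply, depend_apply]
  exact Finset.sup_mono_fun fun k _ => pvc_mono k (h k) m

lemma tsub_le_depend (c : Fin N → ℝ≥0) (k m : Fin N) : c k - ε ≤ depend ε c m := by
  rw [depend_apply]
  refine le_trans ?_ (Finset.le_sup (f := fun k => pvc ε k (c k) m) (Finset.mem_univ k))
  simp only [pvc]
  split_ifs
  · exact tsub_le_self
  · exact le_rfl

/-- If the dependency vector exceeds the frontier at `m`, then its entry comes from some event of
the frontier, one clock skew earlier. -/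
lemma exists_depend_eq {m : Fin N} (h : c m < depend ε c m) : ∃ k, depend ε c m = c k - ε := by
  obtain ⟨k, -, hk⟩ := Finset.exists_mem_eq_sup Finset.univ ⟨m, Finset.mem_univ m⟩
    (fun k => pvc ε k (c k) m)
  rw [← depend_apply] at hk
  refine ⟨k, ?_⟩
  simp only [pvc] at hk
  split_ifs at hk with hkm
  · subst hkm
    exact absurd hk h.ne'
  · exact hk

lemma consistent_iff : Consistent ε c ↔ ∀ k m, c k ≤ c m + ε := by
  constructor
  · exact fun h k m => tsub_le_iff_right.1 ((tsub_le_depend c k m).trans (h m))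
  · intro h m
    by_contra! hm
    obtain ⟨k, hk⟩ := exists_depend_eq hm
    exact (hk ▸ hm).not_ge (tsub_le_iff_right.2 (h k m))

lemma Consistent.sup (hc : Consistent ε c) (hd : Consistent ε d) : Consistent ε (c ⊔ d) := by
  rw [consistent_iff] at *
  intro k m
  refine sup_le ((hc k m).trans ?_) ((hd k m).trans ?_)
  · exact add_le_add_left le_sup_left ε
  · exact add_le_add_left le_sup_right ε

lemma IsCut.consistent_front {C : Set (Event N)} (hC : IsCut ε C) :
    Consistent ε (front C) := by
  obtain ⟨hdown, hne, huniv⟩ := hC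
  have hloc : ∀ n t t', (n, t') ∈ C → t ≤ t' → (n, t) ∈ C := by
    intro n t t' h1 h2
    rcases h2.eq_or_lt with h2 | h2
    · exact h2 ▸ h1
    · exact hdown _ _ h1 (HB.loc n t t' h2)
  -- A cut that is unbounded on one agent contains every event, because of the skew edges.
  have hbdd : ∀ n, BddAbove {t | (n, t) ∈ C} := by
    intro n
    by_contra h
    rw [not_bddAbove_iff] at h
    refine huniv (eq_univ_of_forall ?_)
    rintro ⟨m, t⟩
    obtain ⟨t', h1, h2⟩ := h (t + ε)
    exact hdown _ _ h1 (HB.skew m n t t' h2.le)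
  rw [consistent_iff]
  intro k m
  refine csSup_le (hne k) fun s hs => ?_
  rw [← tsub_le_iff_right]
  rcases le_total ε s with h | h
  · exact le_csSup (hbdd m) (hdown _ _ hs (HB.skew m k (s - ε) s (tsub_add_cancel_of_le h).le))
  · rw [tsub_eq_zero_of_le h]
    exact zero_le

lemma Consistent.exists_isCut (hN : 0 < N) (hc : Consistent ε c) :
    ∃ C : Set (Event N), IsCut ε C ∧ front C = c := by
  rw [consistent_iff] at hc
  have hfront : front {e : Event N | e.2 ≤ c e.1} = c := by
    funext n
    exact (csSup_Iic : sSup (Iic (c n)) = c n)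
  refine ⟨{e | e.2 ≤ c e.1}, ⟨?_, fun n => ⟨0, (zero_le : 0 ≤ c n)⟩, ?_⟩, hfront⟩
  · intro e f he hfe
    induction hfe with
    | loc n t t' h => exact h.le.trans he
    | skew n m t t' h =>
      exact le_of_add_le_add_right ((h.trans he).trans (hc m n))
    | trans e f g _ _ h1 h2 => exact h1 (h2 he)
  · intro h
    have h1 : ((⟨0, hN⟩, c ⟨0, hN⟩ + 1) : Event N) ∈ {e : Event N | e.2 ≤ c e.1} := h ▸ mem_univ _
    exact (lt_add_one (c ⟨0, hN⟩)).not_ge h1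

lemma exists_mem_shiftLeft (hN : 0 < N) {C : Set (Event N)} {α : ℝ≥0} (hd : Consistent ε d)
    (hle : ∀ n, d n ≤ front C n) (hα : ∀ n, front C n ≤ d n + α) (hne : ∃ n, d n < front C n) :
    ∃ C' ∈ shiftLeft ε C α, front C' = d := by
  obtain ⟨C', hC', hf⟩ := hd.exists_isCut hN
  refine ⟨C', ⟨hC', fun n => front C n - d n, fun n => tsub_le_iff_left.2 (hα n),
    hne.imp fun n => tsub_pos_of_lt, fun n => ?_⟩, hf⟩
  rw [hf, add_tsub_cancel_of_le (hle n)]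

lemma exists_mem_shiftRight (hN : 0 < N) {C : Set (Event N)} {α : ℝ≥0} (hd : Consistent ε d)
    (hle : ∀ n, front C n ≤ d n) (hα : ∀ n, d n ≤ front C n + α) (hne : ∃ n, front C n < d n) :
    ∃ C' ∈ shiftRight ε C α, front C' = d := by
  obtain ⟨C', hC', hf⟩ := hd.exists_isCut hN
  refine ⟨C', ⟨hC', fun n => d n - front C n, fun n => tsub_le_iff_left.2 (hα n),
    hne.imp fun n => tsub_pos_of_lt, fun n => ?_⟩, hf⟩
  rw [hf, add_tsub_cancel_of_le (hle n)]

/-- Finitely many strict inequalities leave some common room. -/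
lemma exists_pos_forall_add_le {ι : Type*} [Finite ι] {p : ι → Prop} {a b : ι → ℝ≥0}
    (h : ∀ i, p i → a i < b i) : ∃ δ : ℝ≥0, 0 < δ ∧ ∀ i, p i → a i + δ ≤ b i := by
  classical
  cases nonempty_fintype ι
  set S : Finset ℝ≥0 := insert 1 ((Finset.univ.filter p).image fun i => b i - a i)
  have hS : S.Nonempty := Finset.insert_nonempty _ _
  refine ⟨S.min' hS, ?_, fun i hi => ?_⟩
  · rw [Finset.lt_min'_iff]
    intro y hy
    rcases Finset.mem_insert.1 hy with rfl | hy
    · exact one_pos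
    · obtain ⟨i, hi, rfl⟩ := Finset.mem_image.1 hy
      exact tsub_pos_of_lt (h i (Finset.mem_filter.1 hi).2)
  · have h1 : S.min' hS ≤ b i - a i := Finset.min'_le _ _ (Finset.mem_insert_of_mem
      (Finset.mem_image.2 ⟨i, Finset.mem_filter.2 ⟨Finset.mem_univ i, hi⟩, rfl⟩))
    rw [add_comm]
    exact (le_tsub_iff_right (h i hi).le).1 h1

end Frontier

/-! ### Frontiers of extremal cuts -/

section Extremal

variable {N : ℕ} {ε : ℝ≥0} {x : Fin N → ℝ≥0 → ℝ} {C : Set (Event N)}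

/-- On the frontier of a leftmost satcut, a positive time that no other event of the frontier
forces is a left root: the frontier can be moved to the left there alone. -/
lemma IsLeftmostSatcut.isLeftRoot (hN : 0 < N) (hx : ∀ n, IsOutputSignal (x n))
    (hC : IsLeftmostSatcut ε x C) {n : Fin N} (hn : 0 < front C n)
    (hfree : ∀ k, k ≠ n → front C k < front C n + ε) : IsLeftRoot (x n) (front C n) := by
  obtain ⟨⟨hcut, hsat⟩, α, hα, hdisj⟩ := hC
  have hcons := consistent_iff.1 hcut.consistent_front
  obtain ⟨δ, hδ, hδ'⟩ := exists_pos_forall_add_le hfree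
  have hβ : 0 < δ ⊓ α ⊓ front C n := lt_inf_iff.2 ⟨lt_inf_iff.2 ⟨hδ, hα⟩, hn⟩
  refine (hx n).isLeftRoot hβ inf_le_right (fun β hβ0 hβ1 => ?_) (hsat n)
  have h1 : β ≤ δ := hβ1.trans (inf_le_left.trans inf_le_left)
  have h2 : β ≤ α := hβ1.trans (inf_le_left.trans inf_le_right)
  have h3 : front C n - β + β = front C n := tsub_add_cancel_of_le (hβ1.trans inf_le_right)
  have hd : Consistent ε (Function.update (front C) n (front C n - β)) := by
    rw [consistent_iff]
    intro k m
    rcases eq_or_ne k n with hk | hk <;> rcases eq_or_ne m n with hm | hm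
    · rw [hk, hm]
      exact le_self_add
    · rw [hk, Function.update_self, Function.update_of_ne hm]
      exact tsub_le_self.trans (hcons n m)
    · rw [hm, Function.update_self, Function.update_of_ne hk]
      have := hδ' k hk
      linarith
    · rw [Function.update_of_ne hk, Function.update_of_ne hm]
      exact hcons k m
  obtain ⟨C', hC', hf⟩ := exists_mem_shiftLeft hN (C := C) (α := α) hd
    (fun m => by
      rcases eq_or_ne m n with rfl | hm
      · rw [Function.update_self]; exact tsub_le_self
      · rw [Function.update_of_ne hm])
    (fun m => by
      rcases eq_or_ne m n with rfl | hm
      · rw [Function.update_self]; linarith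
      · rw [Function.update_of_ne hm]; exact le_self_add)
    ⟨n, by rw [Function.update_self]; linarith⟩
  by_contra! h
  refine Set.disjoint_left.1 hdisj hC' ⟨hC'.1, fun m => ?_⟩
  rw [hf]
  rcases eq_or_ne m n with rfl | hm
  · rwa [Function.update_self]
  · rw [Function.update_of_ne hm]; exact hsat m

lemma IsLeftmostSatcut.front_cases (hN : 0 < N) (hε : 0 < ε) (hx : ∀ n, IsOutputSignal (x n))
    (hC : IsLeftmostSatcut ε x C) (n : Fin N) :
    front C n = 0 ∨ IsLeftRoot (x n) (front C n) ∨
      ∃ k, IsLeftRoot (x k) (front C k) ∧ front C k = front C n + ε := by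
  have hcons := consistent_iff.1 hC.1.1.consistent_front
  rcases eq_zero_or_pos (front C n) with h0 | h0
  · exact Or.inl h0
  refine Or.inr ?_
  by_cases hfree : ∀ k, k ≠ n → front C k < front C n + ε
  · exact Or.inl (hC.isLeftRoot hN hx h0 hfree)
  push Not at hfree
  obtain ⟨k, -, hk⟩ := hfree
  have hk' : front C k = front C n + ε := (hcons k n).antisymm hk
  refine Or.inr ⟨k, hC.isLeftRoot hN hx (by rw [hk']; positivity) fun j _ => ?_, hk'⟩
  have := hcons j n
  linarith

/-- On the frontier of a rightmost cut that satisfies the predicate, a time that no other event of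
the frontier blocks is a right root: the frontier can be moved to the right there alone. -/
lemma IsRightmostCut.isRightRoot (hN : 0 < N) (hx : ∀ n, IsOutputSignal (x n))
    (hC : IsRightmostCut ε x C) (hsat : ∀ n, 0 ≤ x n (front C n)) {n : Fin N}
    (hfree : ∀ k, k ≠ n → front C n < front C k + ε) : IsRightRoot (x n) (front C n) := by
  obtain ⟨hcut, α, hα, hdisj, -⟩ := hC
  have hcons := consistent_iff.1 hcut.consistent_front
  obtain ⟨δ, hδ, hδ'⟩ := exists_pos_forall_add_le hfree
  have hβ : 0 < δ ⊓ α := lt_inf_iff.2 ⟨hδ, hα⟩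
  refine (hx n).isRightRoot_of_nonneg hβ (fun β hβ0 hβ1 => ?_) (hsat n)
  have h1 : β ≤ δ := hβ1.trans inf_le_left
  have h2 : β ≤ α := hβ1.trans inf_le_right
  have hd : Consistent ε (Function.update (front C) n (front C n + β)) := by
    rw [consistent_iff]
    intro k m
    rcases eq_or_ne k n with hk | hk <;> rcases eq_or_ne m n with hm | hm
    · rw [hk, hm]
      exact le_self_add
    · rw [hk, Function.update_self, Function.update_of_ne hm]
      have := hδ' m hm
      linarith
    · rw [hm, Function.update_self, Function.update_of_ne hk]
      have := hcons k n
      linarith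
    · rw [Function.update_of_ne hk, Function.update_of_ne hm]
      exact hcons k m
  obtain ⟨C', hC', hf⟩ := exists_mem_shiftRight hN (C := C) (α := α) hd
    (fun m => by
      rcases eq_or_ne m n with rfl | hm
      · rw [Function.update_self]; exact le_self_add
      · rw [Function.update_of_ne hm])
    (fun m => by
      rcases eq_or_ne m n with rfl | hm
      · rw [Function.update_self]; linarith
      · rw [Function.update_of_ne hm]; exact le_self_add)
    ⟨n, by rw [Function.update_self]; linarith⟩
  by_contra! h
  refine Set.disjoint_left.1 hdisj hC' ⟨hC'.1, fun m => ?_⟩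
  rw [hf]
  rcases eq_or_ne m n with rfl | hm
  · rwa [Function.update_self]
  · rw [Function.update_of_ne hm]; exact hsat m

lemma IsRightmostCut.front_cases_of_sat (hN : 0 < N) (hε : 0 < ε)
    (hx : ∀ n, IsOutputSignal (x n)) (hC : IsRightmostCut ε x C)
    (hsat : ∀ n, 0 ≤ x n (front C n)) (n : Fin N) :
    IsRightRoot (x n) (front C n) ∨
      ∃ k, k ≠ n ∧ IsRightRoot (x k) (front C k) ∧ front C n = front C k + ε := by
  have hcons := consistent_iff.1 hC.1.consistent_front
  by_cases hfree : ∀ k, k ≠ n → front C n < front C k + ε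
  · exact Or.inl (hC.isRightRoot hN hx hsat hfree)
  push Not at hfree
  obtain ⟨k, hkn, hk⟩ := hfree
  have hk' : front C n = front C k + ε := (hcons n k).antisymm hk
  refine Or.inr ⟨k, hkn, hC.isRightRoot hN hx hsat fun j _ => ?_, hk'⟩
  have := hcons n j
  linarith

/-- Moving the whole frontier of a rightmost cut uniformly to the left gives satcuts, so that every
negative event of the frontier is a jump from nonnegative values. -/
lemma IsRightmostCut.dSat (hN : 0 < N) (hx : ∀ n, IsOutputSignal (x n))
    (hC : IsRightmostCut ε x C) (n : Fin N) : DSat (x n) (front C n) := by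
  obtain ⟨hcut, α, hα, -, hleft, hor⟩ := hC
  have hcons := consistent_iff.1 hcut.consistent_front
  rcases le_or_gt 0 (x n (front C n)) with h0 | h0
  · exact Or.inl h0
  rcases hor with hor | ⟨C'', -, δ, -, ⟨k, hk⟩, hδ⟩
  · exact Or.inl (hor.2 n)
  have hk0 : 0 < front C k := by
    rw [← hδ k]
    positivity
  have hnonneg : ∀ β, 0 < β → β ≤ α → 0 ≤ x n (front C n - β) := by
    intro β hβ hβα
    have hd : Consistent ε fun m => front C m - β := by
      rw [consistent_iff]
      intro j m
      rw [tsub_le_iff_right]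
      calc front C j ≤ front C m + ε := hcons j m
        _ ≤ (front C m - β + β) + ε := by gcongr; exact le_tsub_add
        _ = front C m - β + ε + β := by ring
    obtain ⟨C', hC', hf⟩ := exists_mem_shiftLeft hN (C := C) (α := α) hd
      (fun m => tsub_le_self) (fun m => le_tsub_add.trans (by gcongr))
      ⟨k, tsub_lt_self hk0 hβ⟩
    have := (hleft hC').2 n
    rwa [hf] at this
  have hn0 : 0 < front C n := by
    by_contra! h
    have h1 := hnonneg α hα le_rfl
    rw [tsub_eq_zero_of_le (h.trans zero_le), ← le_antisymm h zero_le] at h1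
    exact h0.not_ge h1
  have hβ : 0 < α ⊓ front C n := lt_inf_iff.2 ⟨hα, hn0⟩
  have hint : ∀ β, 0 < β → β ≤ α ⊓ front C n → 0 ≤ x n (front C n - β) :=
    fun β h1 h2 => hnonneg β h1 (h2.trans inf_le_left)
  have := neBot_nhdsLT_of_pos hn0
  exact Or.inr ⟨(hx n).isRightRoot_of_neg hn0
    (eventually_nhdsLT_of_forall_sub (P := fun v => 0 ≤ x n v) hβ inf_le_right hint).frequently h0,
    _, hβ, inf_le_right, hint⟩

/-- If a rightmost cut is negative at `m`, then every cut to its left has to be earlier at `m`, so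
that the event of `m` forces all other events of the frontier. -/
lemma IsRightmostCut.front_cases_of_neg (hN : 0 < N) (hC : IsRightmostCut ε x C) {m : Fin N}
    (hm : x m (front C m) < 0) (n : Fin N) : n = m ∨ front C n = front C m - ε := by
  obtain ⟨hcut, α, hα, -, hleft, -⟩ := hC
  have hcons := consistent_iff.1 hcut.consistent_front
  by_contra! hcon
  obtain ⟨hnm, hn⟩ := hcon
  have hlt : front C m - ε < front C n := (tsub_le_iff_right.2 (hcons m n)).lt_of_ne hn.symm
  -- Move all agents but `m` to the left, as far as `m` and `α` permit.
  set d : Fin N → ℝ≥0 := fun j =>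
    if j = m then front C m else (front C j - α) ⊔ (front C m - ε) with hd_def
  have hdm : d m = front C m := if_pos rfl
  have hdj : ∀ j, j ≠ m → d j = (front C j - α) ⊔ (front C m - ε) := fun j hj => if_neg hj
  have hle : ∀ j, d j ≤ front C j := by
    intro j
    rcases eq_or_ne j m with rfl | hj
    · exact hdm.le
    · rw [hdj j hj]
      exact sup_le tsub_le_self (tsub_le_iff_right.2 (hcons m j))
  have hd : Consistent ε d := by
    rw [consistent_iff]
    intro j k
    rcases eq_or_ne k m with rfl | hk
    · rw [hdm]
      exact (hle j).trans (hcons j k)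
    rw [hdj k hk]
    rcases eq_or_ne j m with rfl | hj
    · rw [hdm]
      exact tsub_le_iff_right.1 le_sup_right
    rw [hdj j hj]
    refine sup_le ?_ (le_sup_right.trans le_self_add)
    refine le_trans ?_ (add_le_add_left le_sup_left ε)
    rw [tsub_le_iff_right]
    calc front C j ≤ front C k + ε := hcons j k
      _ ≤ (front C k - α + α) + ε := by gcongr; exact le_tsub_add
      _ = front C k - α + ε + α := by ring
  obtain ⟨C', hC', hf⟩ := exists_mem_shiftLeft hN (C := C) (α := α) hd hle
    (fun j => by
      rcases eq_or_ne j m with rfl | hj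
      · rw [hdm]; exact le_self_add
      · rw [hdj j hj]
        exact tsub_le_iff_right.1 le_sup_left)
    ⟨n, by
      rw [hdj n hnm]
      exact sup_lt_iff.2 ⟨tsub_lt_self (hlt.trans_le' zero_le) hα, hlt⟩⟩
  have h1 := (hleft hC').2 m
  rw [hf, hdm] at h1
  exact hm.not_ge h1

end Extremal

/-! ### Invariants of the abstractors -/

section Abstractor

variable {N : ℕ} {ε : ℝ≥0} {x : Fin N → ℝ≥0 → ℝ}

/-- The times of the events that the slicer of agent `n` knows from the start or receives at some
point from its abstractor: `0`, the roots of the agent, and the right roots of the other agents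
delayed by the clock skew. -/
def stream (ε : ℝ≥0) (x : Fin N → ℝ≥0 → ℝ) (n : Fin N) : Set ℝ≥0 :=
  {t | t = 0 ∨ t ∈ roots (x n) ∨ ∃ k, k ≠ n ∧ ∃ r, IsRightRoot (x k) r ∧ t = r + ε}

lemma stream_inter_Iic_finite (hroots : ∀ n, StarvationFreeNonZeno (x n)) (n : Fin N) (T : ℝ≥0) :
    (stream ε x n ∩ Iic T).Finite := by
  refine ((finite_singleton (0 : ℝ≥0)).union (((hroots n).2 T).union
    (finite_iUnion fun k => ((hroots k).2 T).image (· + ε)))).subset ?_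
  rintro t ⟨rfl | ht | ⟨k, -, r, hr, rfl⟩, hT⟩
  · exact Or.inl rfl
  · exact Or.inr (Or.inl ⟨ht, hT⟩)
  · exact Or.inr (Or.inr (mem_iUnion.2 ⟨k, r, ⟨Or.inr hr, le_self_add.trans (mem_Iic.1 hT)⟩, rfl⟩))

lemma exists_isLeast_of_inter_Iic_finite {S : Set ℝ≥0} (hS : ∀ T, (S ∩ Iic T).Finite)
    (hne : S.Nonempty) : ∃ a, IsLeast S a := by
  obtain ⟨b, hb⟩ := hne
  obtain ⟨a, ha, hmin⟩ := exists_min_image (S ∩ Iic b) id (hS b) ⟨b, hb, mem_Iic.2 le_rfl⟩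
  refine ⟨a, ha.1, fun c hc => ?_⟩
  rcases le_total c b with h | h
  · exact hmin c ⟨hc, h⟩
  · exact (mem_Iic.1 ha.2).trans h

/-- The invariants of the abstractors. Roots are found, sent and heard in increasing order, no
found root and no heard right root gets lost, and the events received by a slicer always form an
initial segment of its stream. -/
structure AbstractorInv (ε : ℝ≥0) (x : Fin N → ℝ≥0 → ℝ) (st : State N) : Prop where
  found_sub : ∀ n, st.found n ⊆ roots (x n)
  found_down : ∀ n, ∀ r ∈ st.found n, ∀ r' ∈ roots (x n), r' ≤ r → r' ∈ st.found n
  heard_or_chan : ∀ k n, k ≠ n → ∀ r,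
    (r ∈ st.heard n k ∨ r ∈ st.chan k n) ↔ (r ∈ st.found k ∧ IsRightRoot (x k) r)
  chan_self : ∀ n, st.chan n n = []
  chan_sorted : ∀ k n, (st.chan k n).Pairwise (· < ·)
  heard_lt : ∀ k n, ∀ r ∈ st.heard n k, ∀ r' ∈ st.chan k n, r < r'
  found_mem : ∀ n, ∀ r ∈ st.found n, r ∈ st.buffer n ∨ r ∈ st.recv n
  heard_mem : ∀ k n, ∀ r ∈ st.heard n k, r + ε ∈ st.buffer n ∨ r + ε ∈ st.recv n
  buffer_sub : ∀ n, st.buffer n ⊆ stream ε x n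
  recv_sub : ∀ n, st.recv n ⊆ stream ε x n
  zero_mem : ∀ n, 0 ∈ st.recv n
  recv_down : ∀ n, ∀ t ∈ st.recv n, ∀ a ∈ stream ε x n, a ≤ t → a ∈ st.recv n

lemma AbstractorInv.init : AbstractorInv ε x (State.init N) where
  found_sub _ := empty_subset _
  found_down _ _ h := h.elim
  heard_or_chan k n _ r := by simp [State.init]
  chan_self _ := rfl
  chan_sorted _ _ := List.Pairwise.nil
  heard_lt _ _ _ h := h.elim
  found_mem _ _ h := h.elim
  heard_mem _ _ _ h := h.elim
  buffer_sub _ := empty_subset _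
  recv_sub _ _ h := Or.inl h
  zero_mem _ := rfl
  recv_down _ t ht a _ hat := by
    rw [mem_singleton_iff.1 ht] at hat
    exact le_antisymm hat zero_le

lemma AbstractorInv.found_lt {st : State N} (h : AbstractorInv ε x st) {n : Fin N} {r r' : ℝ≥0}
    (hr : r ∈ st.found n) (hr' : r' ∈ roots (x n)) (hr'' : r' ∉ st.found n) : r < r' := by
  by_contra! hle
  exact hr'' (h.found_down n r hr r' hr' hle)

lemma AbstractorInv.ne_of_chan {st : State N} (h : AbstractorInv ε x st) {m n : Fin N} {r : ℝ≥0}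
    {l : List ℝ≥0} (hl : st.chan m n = r :: l) : m ≠ n := by
  rintro rfl
  rw [h.chan_self] at hl
  exact List.cons_ne_nil _ _ hl.symm

lemma AbstractorInv.find {st : State N} (h : AbstractorInv ε x st) {n : Fin N} {r : ℝ≥0}
    (hr : IsLeast (roots (x n) \ st.found n) r) {st' : State N}
    (hfound : st'.found = Function.update st.found n (insert r (st.found n)))
    (hbuffer : st'.buffer = Function.update st.buffer n (insert r (st.buffer n)))
    (hchan : ∀ k m, (k = n ∧ m ≠ n ∧ IsRightRoot (x n) r ∧ st'.chan k m = st.chan k m ++ [r]) ∨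
      (¬ (k = n ∧ m ≠ n ∧ IsRightRoot (x n) r) ∧ st'.chan k m = st.chan k m))
    (hheard : st'.heard = st.heard) (hrecv : st'.recv = st.recv) : AbstractorInv ε x st' where
  found_sub k := by
    rw [hfound]
    rcases eq_or_ne k n with rfl | hk
    · rw [Function.update_self]
      exact insert_subset hr.1.1 (h.found_sub k)
    · rw [Function.update_of_ne hk]
      exact h.found_sub k
  found_down k := by
    rw [hfound]
    rcases eq_or_ne k n with rfl | hk
    · rw [Function.update_self]
      rintro q (rfl | hq) q' hq' hle
      · by_contra hcon
        rw [mem_insert_iff, not_or] at hcon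
        exact hcon.1 (hle.antisymm (hr.2 ⟨hq', hcon.2⟩))
      · exact Or.inr (h.found_down k q hq q' hq' hle)
    · rw [Function.update_of_ne hk]
      exact h.found_down k
  heard_or_chan k m hkm q := by
    have h0 := h.heard_or_chan k m hkm q
    rw [hheard, hfound]
    rcases hchan k m with ⟨rfl, -, hrr, hc⟩ | ⟨hn, hc⟩
    · rw [hc, Function.update_self, List.mem_append, List.mem_singleton, mem_insert_iff, ← or_assoc,
        h0]
      constructor
      · rintro (h1 | rfl)
        · exact ⟨Or.inr h1.1, h1.2⟩
        · exact ⟨Or.inl rfl, hrr⟩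
      · rintro ⟨h1 | h1, h2⟩
        · exact Or.inr h1
        · exact Or.inl ⟨h1, h2⟩
    · rw [hc, h0]
      rcases eq_or_ne k n with rfl | hk
      · rw [Function.update_self, mem_insert_iff]
        refine ⟨fun h1 => ⟨Or.inr h1.1, h1.2⟩, ?_⟩
        rintro ⟨rfl | h1, h2⟩
        · exact absurd ⟨rfl, hkm.symm, h2⟩ hn
        · exact ⟨h1, h2⟩
      · rw [Function.update_of_ne hk]
  chan_self k := by
    rcases hchan k k with ⟨h1, h2, -⟩ | ⟨-, hc⟩
    · exact absurd h1 h2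
    · rw [hc, h.chan_self]
  chan_sorted k m := by
    rcases hchan k m with ⟨rfl, hm, -, hc⟩ | ⟨-, hc⟩
    · rw [hc, List.pairwise_append]
      refine ⟨h.chan_sorted k m, List.pairwise_singleton _ _, fun a ha b hb => ?_⟩
      rw [List.mem_singleton.1 hb]
      exact h.found_lt ((h.heard_or_chan k m hm.symm a).1 (Or.inr ha)).1 hr.1.1 hr.1.2
    · rw [hc]
      exact h.chan_sorted k m
  heard_lt k m q hq q' hq' := by
    rw [hheard] at hq
    rcases hchan k m with ⟨rfl, hm, -, hc⟩ | ⟨-, hc⟩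
    · rw [hc, List.mem_append, List.mem_singleton] at hq'
      rcases hq' with hq' | rfl
      · exact h.heard_lt k m q hq q' hq'
      · exact h.found_lt ((h.heard_or_chan k m hm.symm q).1 (Or.inl hq)).1 hr.1.1 hr.1.2
    · rw [hc] at hq'
      exact h.heard_lt k m q hq q' hq'
  found_mem k q hq := by
    rw [hbuffer, hrecv]
    rw [hfound] at hq
    rcases eq_or_ne k n with rfl | hk
    · rw [Function.update_self] at hq ⊢
      rcases hq with rfl | hq
      · exact Or.inl (mem_insert _ _)
      · exact (h.found_mem k q hq).imp_left (mem_insert_of_mem _)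
    · rw [Function.update_of_ne hk] at hq ⊢
      exact h.found_mem k q hq
  heard_mem k m q hq := by
    rw [hheard] at hq
    rw [hbuffer, hrecv]
    rcases eq_or_ne m n with rfl | hm
    · rw [Function.update_self]
      exact (h.heard_mem k m q hq).imp_left (mem_insert_of_mem _)
    · rw [Function.update_of_ne hm]
      exact h.heard_mem k m q hq
  buffer_sub k := by
    rw [hbuffer]
    rcases eq_or_ne k n with rfl | hk
    · rw [Function.update_self]
      exact insert_subset (Or.inr (Or.inl hr.1.1)) (h.buffer_sub k)
    · rw [Function.update_of_ne hk]
      exact h.buffer_sub k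
  recv_sub := hrecv ▸ h.recv_sub
  zero_mem := hrecv ▸ h.zero_mem
  recv_down := hrecv ▸ h.recv_down

lemma AbstractorInv.hear {st : State N} (h : AbstractorInv ε x st) {m n : Fin N} {r : ℝ≥0}
    {l : List ℝ≥0} (hl : st.chan m n = r :: l) {st' : State N} (hfound : st'.found = st.found)
    (hchan : ∀ k j, (k = m ∧ j = n ∧ st'.chan k j = l ∧
        st'.heard j k = insert r (st.heard j k)) ∨
      (st'.chan k j = st.chan k j ∧ st'.heard j k = st.heard j k))
    (hbuffer : st'.buffer = Function.update st.buffer n (insert (r + ε) (st.buffer n)))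
    (hrecv : st'.recv = st.recv) : AbstractorInv ε x st' where
  found_sub := hfound ▸ h.found_sub
  found_down := hfound ▸ h.found_down
  heard_or_chan k j hkj q := by
    rw [hfound, ← h.heard_or_chan k j hkj q]
    rcases hchan k j with ⟨rfl, rfl, hc, hh⟩ | ⟨hc, hh⟩
    · rw [hc, hh, hl, mem_insert_iff, List.mem_cons]
      tauto
    · rw [hc, hh]
  chan_self k := by
    rcases hchan k k with ⟨rfl, h1, -⟩ | ⟨hc, -⟩
    · exact absurd h1 (h.ne_of_chan hl)
    · rw [hc, h.chan_self]
  chan_sorted k j := by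
    have h0 := h.chan_sorted k j
    rcases hchan k j with ⟨rfl, rfl, hc, -⟩ | ⟨hc, -⟩
    · rw [hl] at h0
      rw [hc]
      exact h0.of_cons
    · rwa [hc]
  heard_lt k j q hq q' hq' := by
    have h0 := h.chan_sorted k j
    have h1 := h.heard_lt k j
    rcases hchan k j with ⟨rfl, rfl, hc, hh⟩ | ⟨hc, hh⟩
    · rw [hc] at hq'
      rw [hh] at hq
      rw [hl] at h0 h1
      rcases hq with rfl | hq
      · exact List.rel_of_pairwise_cons h0 hq'
      · exact h1 q hq q' (List.mem_cons_of_mem _ hq')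
    · rw [hc] at hq'
      rw [hh] at hq
      exact h1 q hq q' hq'
  found_mem k q hq := by
    rw [hfound] at hq
    rw [hbuffer, hrecv]
    rcases eq_or_ne k n with rfl | hk
    · rw [Function.update_self]
      exact (h.found_mem k q hq).imp_left (mem_insert_of_mem _)
    · rw [Function.update_of_ne hk]
      exact h.found_mem k q hq
  heard_mem k j q hq := by
    have h0 : q ∈ st.heard j k → q + ε ∈ st'.buffer j ∨ q + ε ∈ st'.recv j := by
      intro hq
      rw [hbuffer, hrecv]
      rcases eq_or_ne j n with rfl | hj
      · rw [Function.update_self]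
        exact (h.heard_mem k j q hq).imp_left (mem_insert_of_mem _)
      · rw [Function.update_of_ne hj]
        exact h.heard_mem k j q hq
    rcases hchan k j with ⟨-, rfl, -, hh⟩ | ⟨-, hh⟩
    · rw [hh] at hq
      rcases hq with rfl | hq
      · left
        rw [hbuffer, Function.update_self]
        exact mem_insert _ _
      · exact h0 hq
    · exact h0 (hh ▸ hq)
  buffer_sub k := by
    rw [hbuffer]
    rcases eq_or_ne k n with rfl | hk
    · rw [Function.update_self]
      have hm := h.ne_of_chan hl
      refine insert_subset (Or.inr (Or.inr ⟨m, hm, r, ?_, rfl⟩)) (h.buffer_sub k)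
      exact ((h.heard_or_chan m k hm r).1 (Or.inr (hl ▸ List.mem_cons_self))).2
    · rw [Function.update_of_ne hk]
      exact h.buffer_sub k
  recv_sub := hrecv ▸ h.recv_sub
  zero_mem := hrecv ▸ h.zero_mem
  recv_down := hrecv ▸ h.recv_down

/-- The readiness test of the abstractor makes sure that all earlier events of the stream have been
forwarded before. -/
lemma AbstractorInv.mem_recv_of_ready {st : State N} (h : AbstractorInv ε x st) {n : Fin N}
    {s : ℝ≥0} (hs : IsLeast (st.buffer n) s)
    (hown : ∀ r ∈ roots (x n), r ≤ s → r ∈ st.found n)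
    (hother : ∀ k, k ≠ n → ∃ r ∈ st.heard n k, s ≤ r + ε) {a : ℝ≥0} (ha : a ∈ stream ε x n)
    (has : a ≤ s) : a = s ∨ a ∈ st.recv n := by
  have hmem : a ∈ st.buffer n ∨ a ∈ st.recv n := by
    rcases ha with rfl | ha | ⟨k, hk, r, hr, rfl⟩
    · exact Or.inr (h.zero_mem n)
    · exact h.found_mem n a (hown a ha has)
    · obtain ⟨r', hr', hle⟩ := hother k hk
      have hrr : r ≤ r' := le_of_add_le_add_right (has.trans hle)
      have hf := h.found_down k r' ((h.heard_or_chan k n hk r').1 (Or.inl hr')).1 r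
        (Or.inr hr) hrr
      rcases (h.heard_or_chan k n hk r).2 ⟨hf, hr⟩ with h1 | h1
      · exact h.heard_mem k n r h1
      · exact absurd (h.heard_lt k n r' hr' r h1) hrr.not_gt
  exact hmem.imp_left fun h1 => has.antisymm (hs.2 h1)

lemma AbstractorInv.forward {st : State N} (h : AbstractorInv ε x st) {n : Fin N} {s : ℝ≥0}
    (hs : IsLeast (st.buffer n) s) (hown : ∀ r ∈ roots (x n), r ≤ s → r ∈ st.found n)
    (hother : ∀ k, k ≠ n → ∃ r ∈ st.heard n k, s ≤ r + ε) {st' : State N}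
    (hfound : st'.found = st.found) (hchan : st'.chan = st.chan) (hheard : st'.heard = st.heard)
    (hbuffer : st'.buffer = Function.update st.buffer n (st.buffer n \ {s}))
    (hrecv : st'.recv = Function.update st.recv n (insert s (st.recv n))) :
    AbstractorInv ε x st' := by
  have hkeep : ∀ k q, q ∈ st.buffer k ∨ q ∈ st.recv k → q ∈ st'.buffer k ∨ q ∈ st'.recv k := by
    intro k q hq
    rw [hbuffer, hrecv]
    rcases eq_or_ne k n with rfl | hk
    · rw [Function.update_self, Function.update_self]
      by_cases hqs : q = s
      · exact Or.inr (Or.inl hqs)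
      · exact hq.imp (fun h1 => ⟨h1, hqs⟩) Or.inr
    · rwa [Function.update_of_ne hk, Function.update_of_ne hk]
  refine ⟨hfound ▸ h.found_sub, hfound ▸ h.found_down, ?_, hchan ▸ h.chan_self,
    hchan ▸ h.chan_sorted, ?_, ?_, ?_, fun k => ?_, fun k => ?_, fun k => ?_, fun k => ?_⟩
  · rw [hfound, hchan, hheard]
    exact h.heard_or_chan
  · rw [hchan, hheard]
    exact h.heard_lt
  · rw [hfound]
    exact fun k q hq => hkeep k q (h.found_mem k q hq)
  · rw [hheard]
    exact fun k j q hq => hkeep j _ (h.heard_mem k j q hq)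
  · rw [hbuffer]
    rcases eq_or_ne k n with rfl | hk
    · rw [Function.update_self]
      exact sdiff_subset.trans (h.buffer_sub k)
    · rw [Function.update_of_ne hk]
      exact h.buffer_sub k
  · rw [hrecv]
    rcases eq_or_ne k n with rfl | hk
    · rw [Function.update_self]
      exact insert_subset (h.buffer_sub k hs.1) (h.recv_sub k)
    · rw [Function.update_of_ne hk]
      exact h.recv_sub k
  · rw [hrecv]
    rcases eq_or_ne k n with rfl | hk
    · rw [Function.update_self]
      exact Or.inr (h.zero_mem k)
    · rw [Function.update_of_ne hk]
      exact h.zero_mem k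
  · rw [hrecv]
    rcases eq_or_ne k n with rfl | hk
    · rw [Function.update_self]
      rintro t (rfl | ht) a ha hat
      · exact h.mem_recv_of_ready hs hown hother ha hat
      · exact Or.inr (h.recv_down k t ht a ha hat)
    · rw [Function.update_of_ne hk]
      exact h.recv_down k

lemma AbstractorInv.step {st st' : State N} {a : Action N} (h : AbstractorInv ε x st)
    (hst : Step ε x a st st') : AbstractorInv ε x st' := by
  cases hst with
  | find _ n r hr =>
    refine h.find hr rfl rfl (fun k m => ?_) rfl rfl
    by_cases hc : k = n ∧ m ≠ n ∧ IsRightRoot (x n) r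
    · exact Or.inl ⟨hc.1, hc.2.1, hc.2.2, if_pos hc⟩
    · exact Or.inr ⟨hc, if_neg hc⟩
  | hear _ m n r l hl =>
    refine h.hear hl rfl (fun k j => ?_) rfl rfl
    by_cases hc : k = m ∧ j = n
    · exact Or.inl ⟨hc.1, hc.2, if_pos hc, if_pos hc.symm⟩
    · exact Or.inr ⟨if_neg hc, if_neg fun h1 => hc h1.symm⟩
  | forward _ n s hs hown hother => exact h.forward hs hown hother rfl rfl rfl rfl rfl
  | move _ n m s ev tgt harr htgt =>
    exact ⟨h.found_sub, h.found_down, h.heard_or_chan, h.chan_self, h.chan_sorted, h.heard_lt,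
      h.found_mem, h.heard_mem, h.buffer_sub, h.recv_sub, h.zero_mem, h.recv_down⟩

end Abstractor

/-! ### Invariants of the tokens -/

section Token

variable {N : ℕ} {ε : ℝ≥0} {x : Fin N → ℝ≥0 → ℝ}

lemma Arrives.cases {st : State N} {n m : Fin N} {s ev : ℝ≥0} (h : Arrives st n m s ev) :
    ((st.token n).target = .home ∧ m = n ∧ IsLeast {t ∈ st.recv n | (st.token n).event < t} s ∧
      ev = s) ∨
    ((st.token n).target = .dep m s ∧ (s ∈ st.log m ∨ ∃ t ∈ st.recv m, s < t) ∧
      ev = (st.token n).event) ∨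
    (∃ s', (st.token n).target = .next m s' ∧ IsLeast {t ∈ st.log m | s' < t} s ∧
      ev = (st.token n).event) := by
  unfold Arrives at h
  split at h
  · next ht => exact Or.inl ⟨ht, h⟩
  · next m' s' ht =>
    obtain ⟨rfl, rfl, h1, h2⟩ := h
    exact Or.inr (Or.inl ⟨ht, h2, h1⟩)
  · next m' s' ht =>
    obtain ⟨rfl, h1, h2⟩ := h
    exact Or.inr (Or.inr ⟨s', ht, h1, h2⟩)

lemma Arrives.event_le {st : State N} {n m : Fin N} {s ev : ℝ≥0} (h : Arrives st n m s ev) :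
    (st.token n).event ≤ ev := by
  rcases h.cases with ⟨-, -, hs, rfl⟩ | ⟨-, -, rfl⟩ | ⟨_, -, -, rfl⟩
  · exact hs.1.2.le
  · exact le_rfl
  · exact le_rfl

lemma State.le_newCut (st : State N) (n m : Fin N) (s : ℝ≥0) :
    (st.token n).cut ≤ st.newCut n m s := by
  intro k
  unfold State.newCut
  rcases eq_or_ne k m with rfl | hk
  · rw [Function.update_self]
    exact le_sup_left
  · rw [Function.update_of_ne hk]

lemma State.newCut_le {st : State N} {n m : Fin N} {s : ℝ≥0} {c : Fin N → ℝ≥0}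
    (h : (st.token n).cut ≤ c) (hs : s ≤ c m) : st.newCut n m s ≤ c := by
  intro k
  unfold State.newCut
  rcases eq_or_ne k m with rfl | hk
  · rw [Function.update_self]
    exact sup_le (h k) hs
  · rw [Function.update_of_ne hk]
    exact h k

lemma State.le_newCut_self (st : State N) (n m : Fin N) (s : ℝ≥0) : s ≤ st.newCut n m s m := by
  unfold State.newCut
  rw [Function.update_self]
  exact le_sup_right

lemma Step.found_subset {a : Action N} {st st' : State N} (h : Step ε x a st st') (n : Fin N) :
    st.found n ⊆ st'.found n := by
  cases h with
  | find _ k r hr =>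
    rcases eq_or_ne n k with rfl | hk
    · simp
    · simp [Function.update_of_ne hk]
  | _ => exact Subset.rfl

lemma Step.heard_subset {a : Action N} {st st' : State N} (h : Step ε x a st st') (n k : Fin N) :
    st.heard n k ⊆ st'.heard n k := by
  cases h with
  | hear _ m j r l hl =>
    intro q hq
    change q ∈ if n = j ∧ k = m then insert r (st.heard n k) else st.heard n k
    split_ifs
    · exact Or.inr hq
    · exact hq
  | _ => exact Subset.rfl

lemma Step.recv_subset {a : Action N} {st st' : State N} (h : Step ε x a st st') (n : Fin N) :
    st.recv n ⊆ st'.recv n := by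
  cases h with
  | forward _ k s hs hown hother =>
    rcases eq_or_ne n k with rfl | hk
    · simp
    · simp [Function.update_of_ne hk]
  | _ => exact Subset.rfl

lemma Step.log_subset {a : Action N} {st st' : State N} (h : Step ε x a st st') (n : Fin N) :
    st.log n ⊆ st'.log n := by
  cases h with
  | forward _ k s hs hown hother =>
    rcases eq_or_ne n k with rfl | hk
    · simp
    · simp [Function.update_of_ne hk]
  | move _ j k s ev tgt harr htgt =>
    rcases eq_or_ne n k with rfl | hk
    · simp
    · simp [Function.update_of_ne hk]
  | _ => exact Subset.rfl

lemma Step.out_subset {a : Action N} {st st' : State N} (h : Step ε x a st st') :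
    st.out ⊆ st'.out := by
  cases h with
  | move _ j k s ev tgt harr htgt => exact fun c hc => Or.inl hc
  | _ => exact Subset.rfl

lemma Step.token_eq_or {a : Action N} {st st' : State N} (h : Step ε x a st st') (n : Fin N) :
    st'.token n = st.token n ∨ a = .move n := by
  cases h with
  | move _ j k s ev tgt harr htgt =>
    rcases eq_or_ne n j with rfl | hj
    · exact Or.inr rfl
    · exact Or.inl (Function.update_of_ne hj _ _)
  | _ => exact Or.inl rfl

lemma Step.move_cases {n : Fin N} {st st' : State N} (h : Step ε x (.move n) st st') :
    ∃ m s ev tgt, Arrives st n m s ev ∧ Assess ε x (st.newCut n m s) tgt ∧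
      st'.token n = ⟨ev, st.newCut n m s, tgt⟩ := by
  cases h with
  | move _ _ m s ev tgt harr htgt => exact ⟨m, s, ev, tgt, harr, htgt, Function.update_self _ _ _⟩

lemma Step.token_mono {a : Action N} {st st' : State N} (h : Step ε x a st st') (n : Fin N) :
    (st.token n).event ≤ (st'.token n).event ∧ (st.token n).cut ≤ (st'.token n).cut := by
  rcases h.token_eq_or n with h1 | rfl
  · rw [h1]
    exact ⟨le_rfl, le_rfl⟩
  · obtain ⟨m, s, ev, tgt, h1, -, h2⟩ := h.move_cases
    rw [h2]
    exact ⟨h1.event_le, st.le_newCut n m s⟩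

/-- The invariants of the slicers and the tokens. The target of a token is the one that the
assessment of its frontier asks for, apart from the initial target. -/
structure TokenInv (ε : ℝ≥0) (x : Fin N → ℝ≥0 → ℝ) (st : State N) : Prop where
  recv_sub_log : ∀ n, st.recv n ⊆ st.log n
  log_le : ∀ n, ∀ s ∈ st.log n, ∃ t ∈ st.recv n, s ≤ t
  log_finite : ∀ n, (st.log n).Finite
  cut_mem : ∀ n m, (st.token n).cut m ∈ st.log m
  event_mem : ∀ n, (st.token n).event ∈ st.recv n
  event_le : ∀ n, (st.token n).event ≤ (st.token n).cut n
  assess : ∀ n, Assess ε x (st.token n).cut (st.token n).target ∨ (st.token n).target = .dep n 0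
  home_out : ∀ n, (st.token n).target = .home → (st.token n).cut ∈ st.out
  out_sat : ∀ c ∈ st.out, IsDiscreteSatcut ε x st c

lemma TokenInv.init : TokenInv ε x (State.init N) where
  recv_sub_log _ := Subset.rfl
  log_le _ s hs := ⟨s, hs, le_rfl⟩
  log_finite _ := finite_singleton 0
  cut_mem _ _ := rfl
  event_mem _ := rfl
  event_le _ := le_rfl
  assess _ := Or.inr rfl
  home_out _ h := nomatch h
  out_sat _ h := h.elim

lemma IsDiscreteSatcut.mono {st st' : State N} {c : Fin N → ℝ≥0}
    (h : IsDiscreteSatcut ε x st c) (hlog : ∀ n, st.log n ⊆ st'.log n) :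
    IsDiscreteSatcut ε x st' c :=
  ⟨fun m => hlog m (h.1 m), h.2⟩

lemma TokenInv.forward {st st' : State N} (h : TokenInv ε x st) {n : Fin N} {s : ℝ≥0}
    (hrecv : st'.recv = Function.update st.recv n (insert s (st.recv n)))
    (hlog : st'.log = Function.update st.log n (insert s (st.log n)))
    (htoken : st'.token = st.token) (hout : st'.out = st.out)
    (hrecv_le : ∀ n, st.recv n ⊆ st'.recv n) (hlog_le : ∀ n, st.log n ⊆ st'.log n) :
    TokenInv ε x st' where
  recv_sub_log k := by
    rw [hrecv, hlog]
    rcases eq_or_ne k n with rfl | hk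
    · rw [Function.update_self, Function.update_self]
      exact insert_subset_insert (h.recv_sub_log k)
    · rw [Function.update_of_ne hk, Function.update_of_ne hk]
      exact h.recv_sub_log k
  log_le k t ht := by
    rw [hlog] at ht
    rcases eq_or_ne k n with rfl | hk
    · rw [Function.update_self] at ht
      rcases ht with rfl | ht
      · refine ⟨t, ?_, le_rfl⟩
        rw [hrecv, Function.update_self]
        exact mem_insert _ _
      · obtain ⟨u, hu, htu⟩ := h.log_le k t ht
        exact ⟨u, hrecv_le k hu, htu⟩
    · rw [Function.update_of_ne hk] at ht
      obtain ⟨u, hu, htu⟩ := h.log_le k t ht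
      exact ⟨u, hrecv_le k hu, htu⟩
  log_finite k := by
    rw [hlog]
    rcases eq_or_ne k n with rfl | hk
    · rw [Function.update_self]
      exact (h.log_finite k).insert s
    · rw [Function.update_of_ne hk]
      exact h.log_finite k
  cut_mem k m := hlog_le m (htoken ▸ h.cut_mem k m)
  event_mem k := hrecv_le k (htoken ▸ h.event_mem k)
  event_le := htoken ▸ h.event_le
  assess := htoken ▸ h.assess
  home_out := htoken ▸ hout ▸ h.home_out
  out_sat c hc := (h.out_sat c (hout ▸ hc)).mono hlog_le

lemma TokenInv.mem_log_or {st : State N} (h : TokenInv ε x st) {n m : Fin N} {s ev : ℝ≥0}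
    (harr : Arrives st n m s ev) : s ∈ st.log m ∨ ∃ t ∈ st.recv m, s < t := by
  rcases harr.cases with ⟨-, rfl, hs, -⟩ | ⟨-, hs, -⟩ | ⟨s', -, hs, -⟩
  · exact Or.inl (h.recv_sub_log m hs.1.1)
  · exact hs
  · exact Or.inl hs.1.1

lemma TokenInv.move {st st' : State N} (h : TokenInv ε x st) {n m : Fin N} {s ev : ℝ≥0}
    {tgt : Target N} (harr : Arrives st n m s ev) (htgt : Assess ε x (st.newCut n m s) tgt)
    (hrecv : st'.recv = st.recv) (hlog : st'.log = Function.update st.log m (insert s (st.log m)))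
    (htoken : st'.token = Function.update st.token n ⟨ev, st.newCut n m s, tgt⟩)
    (hout : ∀ c, c ∈ st'.out ↔ c ∈ st.out ∨ (tgt = .home ∧ c = st.newCut n m s))
    (hlog_le : ∀ n, st.log n ⊆ st'.log n) : TokenInv ε x st' := by
  have hs : s ∈ st'.log m := by
    rw [hlog, Function.update_self]
    exact mem_insert _ _
  have hcut : ∀ k, st.newCut n m s k ∈ st'.log k := by
    intro k
    unfold State.newCut
    rcases eq_or_ne k m with rfl | hk
    · rw [Function.update_self]
      rcases le_total s ((st.token n).cut k) with h1 | h1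
      · rw [sup_eq_left.2 h1]
        exact hlog_le k (h.cut_mem n k)
      · rwa [sup_eq_right.2 h1]
    · rw [Function.update_of_ne hk]
      exact hlog_le k (h.cut_mem n k)
  have hev : ev ∈ st.recv n ∧ ev ≤ st.newCut n m s n := by
    have h0 := (h.event_le n).trans (st.le_newCut n m s n)
    rcases harr.cases with ⟨-, rfl, h1, rfl⟩ | ⟨-, -, rfl⟩ | ⟨_, -, -, rfl⟩
    · exact ⟨h1.1.1, st.le_newCut_self m m ev⟩
    · exact ⟨h.event_mem n, h0⟩
    · exact ⟨h.event_mem n, h0⟩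
  have htok : ∀ k, st'.token k = st.token k ∨
      (k = n ∧ st'.token k = ⟨ev, st.newCut n m s, tgt⟩) := by
    intro k
    rw [htoken]
    rcases eq_or_ne k n with rfl | hk
    · exact Or.inr ⟨rfl, Function.update_self _ _ _⟩
    · exact Or.inl (Function.update_of_ne hk _ _)
  refine ⟨fun k => ?_, fun k t ht => ?_, fun k => ?_, fun k j => ?_, fun k => ?_, fun k => ?_,
    fun k => ?_, fun k hk => ?_, fun c hc => ?_⟩
  · rw [hrecv]
    exact (h.recv_sub_log k).trans (hlog_le k)
  · rw [hrecv]
    rw [hlog] at ht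
    rcases eq_or_ne k m with rfl | hk
    · rw [Function.update_self] at ht
      rcases ht with rfl | ht
      · rcases h.mem_log_or harr with h1 | ⟨u, hu, htu⟩
        · exact h.log_le k t h1
        · exact ⟨u, hu, htu.le⟩
      · exact h.log_le k t ht
    · rw [Function.update_of_ne hk] at ht
      exact h.log_le k t ht
  · rw [hlog]
    rcases eq_or_ne k m with rfl | hk
    · rw [Function.update_self]
      exact (h.log_finite k).insert s
    · rw [Function.update_of_ne hk]
      exact h.log_finite k
  · rcases htok k with h1 | ⟨rfl, h1⟩
    · rw [h1]
      exact hlog_le j (h.cut_mem k j)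
    · rw [h1]
      exact hcut j
  · rw [hrecv]
    rcases htok k with h1 | ⟨rfl, h1⟩
    · rw [h1]
      exact h.event_mem k
    · rw [h1]
      exact hev.1
  · rcases htok k with h1 | ⟨rfl, h1⟩
    · rw [h1]
      exact h.event_le k
    · rw [h1]
      exact hev.2
  · rcases htok k with h1 | ⟨rfl, h1⟩
    · rw [h1]
      exact h.assess k
    · rw [h1]
      exact Or.inl htgt
  · rw [hout]
    rcases htok k with h1 | ⟨rfl, h1⟩
    · rw [h1] at hk ⊢
      exact Or.inl (h.home_out k hk)
    · rw [h1] at hk ⊢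
      exact Or.inr ⟨hk, rfl⟩
  · rcases (hout c).1 hc with hc | ⟨rfl, rfl⟩
    · exact (h.out_sat c hc).mono hlog_le
    · exact ⟨hcut, htgt⟩

lemma TokenInv.step {st st' : State N} {a : Action N} (h : TokenInv ε x st)
    (hst : Step ε x a st st') : TokenInv ε x st' := by
  have hlog := hst.log_subset
  have hrecv := hst.recv_subset
  cases hst with
  | find _ n r hr =>
    exact ⟨h.recv_sub_log, h.log_le, h.log_finite, h.cut_mem, h.event_mem, h.event_le, h.assess,
      h.home_out, h.out_sat⟩
  | hear _ m n r l hl =>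
    exact ⟨h.recv_sub_log, h.log_le, h.log_finite, h.cut_mem, h.event_mem, h.event_le, h.assess,
      h.home_out, h.out_sat⟩
  | forward _ n s hs hown hother => exact h.forward rfl rfl rfl rfl hrecv hlog
  | move _ n m s ev tgt harr htgt => exact h.move harr htgt rfl rfl rfl (fun c => Iff.rfl) hlog

/-- The relation between the tokens and a consistent satisfying frontier `c`: while a token works
on events up to its entry of `c`, it does not get past `c`; and when it has passed this entry, then
it has output a cut below `c` that reaches this entry. -/
structure Guarded (ε : ℝ≥0) (x : Fin N → ℝ≥0 → ℝ) (c : Fin N → ℝ≥0) (st : State N) : Prop where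
  cut_le : ∀ n, (st.token n).event ≤ c n → (st.token n).cut ≤ c
  exists_out : ∀ n, c n ∈ stream ε x n → c n < (st.token n).event →
    ∃ d ∈ st.out, d ≤ c ∧ c n ≤ d n

lemma Guarded.init (c : Fin N → ℝ≥0) : Guarded ε x c (State.init N) where
  cut_le _ _ _ := zero_le
  exists_out _ _ h := absurd h (zero_le : (0 : ℝ≥0) ≤ _).not_gt

/-- A token that incorporates an event does not overtake `c`. For a required event, this is the
consistency of `c`. For the successor of a violating event, it is because the signal has a root
between the violating event and the satisfying one on `c`; the slicer stores this root if it stores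
any later event. -/
lemma Guarded.target_le {c : Fin N → ℝ≥0} {st : State N} (hx : ∀ n, IsOutputSignal (x n))
    (hc : Consistent ε c) (hsat : ∀ m, DSat (x m) (c m)) (hA : AbstractorInv ε x st)
    (hT : TokenInv ε x st) {n m : Fin N} {s ev : ℝ≥0} (harr : Arrives st n m s ev)
    (hcut : (st.token n).cut ≤ c) (hev : ev ≤ c n) : s ≤ c m := by
  have hassess := hT.assess n
  rcases harr.cases with ⟨-, rfl, -, rfl⟩ | ⟨htgt, -, -⟩ | ⟨s', htgt, hs, -⟩
  · exact hev
  · rw [htgt] at hassess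
    rcases hassess with ⟨-, hs⟩ | h0
    · rw [hs]
      exact (depend_mono hcut m).trans (hc m)
    · have hs0 : s = 0 := by
        injection h0
      rw [hs0]
      exact zero_le
  · rw [htgt] at hassess
    obtain ⟨-, hviol, rfl⟩ := hassess.resolve_right nofun
    have hlt : (st.token n).cut m < c m :=
      (hcut m).lt_of_ne fun h => hviol (h ▸ hsat m)
    obtain ⟨u, hu, hlu, huc⟩ := (hx m).exists_root_of_dSat hlt hviol (hsat m)
    by_contra! hcs
    obtain ⟨t, ht, hst⟩ := hT.log_le m s hs.1.1
    have hur : u ∈ st.recv m :=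
      hA.recv_down m t ht u (Or.inr (Or.inl hu)) ((huc.trans hcs.le).trans hst)
    exact (huc.trans_lt hcs).not_ge (hs.2 ⟨hT.recv_sub_log m hur, hlu⟩)

lemma Guarded.step {c : Fin N → ℝ≥0} (hx : ∀ n, IsOutputSignal (x n)) (hc : Consistent ε c)
    (hsat : ∀ m, DSat (x m) (c m)) {st st' : State N} {a : Action N} (hA : AbstractorInv ε x st)
    (hT : TokenInv ε x st) (h : Guarded ε x c st) (hst : Step ε x a st st') :
    Guarded ε x c st' := by
  refine ⟨fun n => ?_, fun n hn => ?_⟩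
  · rcases hst.token_eq_or n with h1 | rfl
    · rw [h1]
      exact h.cut_le n
    · obtain ⟨m, s, ev, tgt, harr, -, h2⟩ := hst.move_cases
      rw [h2]
      intro hev
      have hcut := h.cut_le n (harr.event_le.trans hev)
      exact State.newCut_le hcut (Guarded.target_le hx hc hsat hA hT harr hcut hev)
  · have hold : c n < (st.token n).event → ∃ d ∈ st'.out, d ≤ c ∧ c n ≤ d n := by
      intro h1
      obtain ⟨d, hd, h2⟩ := h.exists_out n hn h1
      exact ⟨d, hst.out_subset hd, h2⟩
    rcases hst.token_eq_or n with h1 | rfl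
    · rw [h1]
      exact hold
    · obtain ⟨m, s, ev, tgt, harr, -, h2⟩ := hst.move_cases
      rw [h2]
      intro hev
      rcases lt_or_ge (c n) (st.token n).event with h3 | h3
      · exact hold h3
      rcases harr.cases with ⟨htgt, rfl, hs, rfl⟩ | ⟨-, -, rfl⟩ | ⟨_, -, -, rfl⟩
      · -- The token leaves its event for a later one, and the received events come in order, so
        -- that this event is the one of `c`.
        have hcn : c m ∈ st.recv m := hA.recv_down m ev hs.1.1 _ hn hev.le
        have heq : c m ≤ (st.token m).event := by
          by_contra! h4
          exact hev.not_ge (hs.2 ⟨hcn, h4⟩)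
        exact ⟨_, hst.out_subset (hT.home_out m htgt), h.cut_le m h3, heq.trans (hT.event_le m)⟩
      · exact absurd hev h3.not_gt
      · exact absurd hev h3.not_gt

end Token

/-! ### Progress of the abstractors -/

section Run

variable {N : ℕ} {ε : ℝ≥0} {x : Fin N → ℝ≥0 → ℝ} {σ : ℕ → State N}

/-- A sequence that increases inside a finite set cannot change infinitely often. -/
lemma false_of_frequently_ne {α : Type*} [PartialOrder α] {f : ℕ → α} {I : ℕ} {S : Set α}
    (hS : S.Finite) (hmono : ∀ j, I ≤ j → f j ≤ f (j + 1)) (hmem : ∀ j, I ≤ j → f j ∈ S)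
    (hne : ∀ i, I ≤ i → ∃ j, i ≤ j ∧ f j ≠ f (j + 1)) : False := by
  have hle : ∀ i j, I ≤ i → i ≤ j → f i ≤ f j := by
    intro i j hi hij
    induction j, hij using Nat.le_induction with
    | base => exact le_rfl
    | succ j hij ih => exact ih.trans (hmono j (hi.trans hij))
  have hfin : (f '' Ici I).Finite := hS.subset (image_subset_iff.2 hmem)
  obtain ⟨a, ha⟩ := hfin.exists_maximal ⟨f I, I, mem_Ici.2 le_rfl, rfl⟩
  obtain ⟨i, hi, rfl⟩ := ha.prop
  obtain ⟨j, hij, hj⟩ := hne i hi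
  have hIj : I ≤ j := le_trans hi hij
  have hconst : ∀ k, i ≤ k → f k = f i := fun k hk =>
    le_antisymm (ha.2 ⟨k, le_trans hi hk, rfl⟩ (hle i k hi hk)) (hle i k hi hk)
  exact hj ((hconst j hij).trans (hconst (j + 1) (hij.trans j.le_succ)).symm)

lemma IsRun.abstractorInv (hσ : IsRun ε x σ) (i : ℕ) : AbstractorInv ε x (σ i) := by
  induction i with
  | zero => exact hσ.init ▸ AbstractorInv.init
  | succ i ih =>
    obtain ⟨a, ha⟩ := hσ.step i
    exact ih.step ha

lemma IsRun.tokenInv (hσ : IsRun ε x σ) (i : ℕ) : TokenInv ε x (σ i) := by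
  induction i with
  | zero => exact hσ.init ▸ TokenInv.init
  | succ i ih =>
    obtain ⟨a, ha⟩ := hσ.step i
    exact ih.step ha

lemma IsRun.guarded (hσ : IsRun ε x σ) (hx : ∀ n, IsOutputSignal (x n)) {c : Fin N → ℝ≥0}
    (hc : Consistent ε c) (hsat : ∀ m, DSat (x m) (c m)) (i : ℕ) : Guarded ε x c (σ i) := by
  induction i with
  | zero => exact hσ.init ▸ Guarded.init c
  | succ i ih =>
    obtain ⟨a, ha⟩ := hσ.step i
    exact ih.step hx hc hsat (hσ.abstractorInv i) (hσ.tokenInv i) ha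

lemma IsRun.found_mono (hσ : IsRun ε x σ) (n : Fin N) : Monotone fun i => (σ i).found n :=
  monotone_nat_of_le_succ fun i => (hσ.step i).elim fun _ h => h.found_subset n

lemma IsRun.heard_mono (hσ : IsRun ε x σ) (n k : Fin N) : Monotone fun i => (σ i).heard n k :=
  monotone_nat_of_le_succ fun i => (hσ.step i).elim fun _ h => h.heard_subset n k

lemma IsRun.recv_mono (hσ : IsRun ε x σ) (n : Fin N) : Monotone fun i => (σ i).recv n :=
  monotone_nat_of_le_succ fun i => (hσ.step i).elim fun _ h => h.recv_subset n

lemma IsRun.out_mono (hσ : IsRun ε x σ) : Monotone fun i => (σ i).out :=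
  monotone_nat_of_le_succ fun i => (hσ.step i).elim fun _ h => h.out_subset

lemma IsRun.event_mono (hσ : IsRun ε x σ) (n : Fin N) : Monotone fun i => ((σ i).token n).event :=
  monotone_nat_of_le_succ fun i => (hσ.step i).elim fun _ h => (h.token_mono n).1

lemma IsRun.cut_mono (hσ : IsRun ε x σ) (n : Fin N) : Monotone fun i => ((σ i).token n).cut :=
  monotone_nat_of_le_succ fun i => (hσ.step i).elim fun _ h => (h.token_mono n).2

lemma IsRun.exists_step (hσ : IsRun ε x σ) {a : Action N} {i : ℕ}
    (h : ∀ j, i ≤ j → ∃ st, Step ε x a (σ j) st) : ∃ j, i ≤ j ∧ Step ε x a (σ j) (σ (j + 1)) := by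
  obtain ⟨j, hj, h1 | h1⟩ := hσ.fair a i
  · exact absurd (h j hj) h1
  · exact ⟨j, hj, h1⟩

lemma IsRun.eventually_found (hσ : IsRun ε x σ) (hroots : ∀ n, StarvationFreeNonZeno (x n))
    {n : Fin N} {r : ℝ≥0} (hr : r ∈ roots (x n)) : ∀ᶠ j in atTop, r ∈ (σ j).found n := by
  suffices h : ∃ i, r ∈ (σ i).found n by
    obtain ⟨i, hi⟩ := h
    exact eventually_atTop.2 ⟨i, fun j hj => hσ.found_mono n hj hi⟩
  by_contra! hnot
  refine false_of_frequently_ne (f := fun i => (σ i).found n) (I := 0)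
    ((hroots n).2 r).finite_subsets (fun j _ => hσ.found_mono n j.le_succ) (fun j _ q hq => ?_)
    fun i _ => ?_
  · have hA := hσ.abstractorInv j
    exact ⟨hA.found_sub n hq, (hA.found_lt hq hr (hnot j)).le⟩
  · obtain ⟨j, hij, hj⟩ := hσ.exists_step (a := .find n) (i := i) fun j _ => by
      obtain ⟨q, hq⟩ := exists_isLeast_of_inter_Iic_finite
        (S := roots (x n) \ (σ j).found n)
        (fun T => ((hroots n).2 T).subset (inter_subset_inter_left _ sdiff_subset))
        ⟨r, hr, hnot j⟩
      exact ⟨_, Step.find _ n q hq⟩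
    refine ⟨j, hij, ?_⟩
    generalize σ (j + 1) = st' at hj
    cases hj with
    | find _ _ q hq =>
      intro h
      refine hq.1.2 ?_
      rw [h]
      simp

lemma IsRun.eventually_heard (hσ : IsRun ε x σ) (hroots : ∀ n, StarvationFreeNonZeno (x n))
    {k n : Fin N} (hkn : k ≠ n) {r : ℝ≥0} (hr : IsRightRoot (x k) r) :
    ∀ᶠ j in atTop, r ∈ (σ j).heard n k := by
  suffices h : ∃ i, r ∈ (σ i).heard n k by
    obtain ⟨i, hi⟩ := h
    exact eventually_atTop.2 ⟨i, fun j hj => hσ.heard_mono n k hj hi⟩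
  by_contra! hnot
  obtain ⟨I, hI⟩ := eventually_atTop.1 (hσ.eventually_found hroots (Or.inr hr))
  have hchan : ∀ j, I ≤ j → r ∈ (σ j).chan k n := fun j hj =>
    (((hσ.abstractorInv j).heard_or_chan k n hkn r).2 ⟨hI j hj, hr⟩).resolve_left (hnot j)
  refine false_of_frequently_ne (f := fun i => (σ i).heard n k) (I := I)
    ((hroots k).2 r).finite_subsets (fun j _ => hσ.heard_mono n k j.le_succ) (fun j hj q hq => ?_)
    fun i hi => ?_
  · have hA := hσ.abstractorInv j
    exact ⟨Or.inr ((hA.heard_or_chan k n hkn q).1 (Or.inl hq)).2,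
      (hA.heard_lt k n q hq r (hchan j hj)).le⟩
  · obtain ⟨j, hij, hj⟩ := hσ.exists_step (a := .hear k n) (i := i) fun j hij => by
      obtain ⟨q, l, hl⟩ := List.exists_cons_of_ne_nil (List.ne_nil_of_mem (hchan j (hi.trans hij)))
      exact ⟨_, Step.hear _ k n q l hl⟩
    refine ⟨j, hij, ?_⟩
    have hA := hσ.abstractorInv j
    generalize σ (j + 1) = st' at hj
    cases hj with
    | hear _ _ _ q l hl =>
      intro h
      have hq : q ∈ (σ j).heard n k := by
        rw [h]
        simp
      exact lt_irrefl q (hA.heard_lt k n q hq q (hl ▸ List.mem_cons_self))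

/-- After all that an agent needs for the events up to `a` has been found and heard, nothing up to
`a` enters its buffer. -/
lemma AbstractorInv.buffer_subset {st st' : State N} {b : Action N} (h : AbstractorInv ε x st)
    (hst : Step ε x b st st') {n : Fin N} {a : ℝ≥0}
    (hown : ∀ r ∈ roots (x n), r ≤ a → r ∈ st.found n)
    (hother : ∀ k, k ≠ n → ∃ r ∈ st.heard n k, a ≤ r + ε) {s : ℝ≥0} (hs : s ∈ st'.buffer n)
    (hsa : s ≤ a) : s ∈ st.buffer n := by
  cases hst with
  | find _ k r hr =>
    change s ∈ Function.update st.buffer k (insert r (st.buffer k)) n at hs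
    rcases eq_or_ne n k with rfl | hk
    · rw [Function.update_self] at hs
      rcases hs with rfl | hs
      · exact absurd (hown s hr.1.1 hsa) hr.1.2
      · exact hs
    · rwa [Function.update_of_ne hk] at hs
  | hear _ m k r l hl =>
    change s ∈ Function.update st.buffer k (insert (r + ε) (st.buffer k)) n at hs
    rcases eq_or_ne n k with rfl | hk
    · rw [Function.update_self] at hs
      rcases hs with rfl | hs
      · obtain ⟨r', hr', hle⟩ := hother m (h.ne_of_chan hl)
        have h1 := h.heard_lt m n r' hr' r (hl ▸ List.mem_cons_self)
        exact absurd (le_of_add_le_add_right (hsa.trans hle)) h1.not_ge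
      · exact hs
    · rwa [Function.update_of_ne hk] at hs
  | forward _ k q hq hown hother =>
    change s ∈ Function.update st.buffer k (st.buffer k \ {q}) n at hs
    rcases eq_or_ne n k with rfl | hk
    · rw [Function.update_self] at hs
      exact hs.1
    · rwa [Function.update_of_ne hk] at hs
  | move _ k m s ev tgt harr htgt => exact hs

lemma IsRun.eventually_recv (hσ : IsRun ε x σ) (hx : ∀ n, IsOutputSignal (x n))
    (hroots : ∀ n, StarvationFreeNonZeno (x n)) {n : Fin N} {a : ℝ≥0} (ha : a ∈ stream ε x n) :
    ∀ᶠ j in atTop, a ∈ (σ j).recv n := by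
  suffices h : ∃ i, a ∈ (σ i).recv n by
    obtain ⟨i, hi⟩ := h
    exact eventually_atTop.2 ⟨i, fun j hj => hσ.recv_mono n hj hi⟩
  by_contra! hnot
  have hbuf : ∀ᶠ j in atTop, a ∈ (σ j).buffer n := by
    rcases ha with rfl | ha | ⟨k, hk, r, hr, rfl⟩
    · exact absurd ((hσ.abstractorInv 0).zero_mem n) (hnot 0)
    · filter_upwards [hσ.eventually_found hroots ha] with j hj
      exact ((hσ.abstractorInv j).found_mem n a hj).resolve_right (hnot j)
    · filter_upwards [hσ.eventually_heard hroots hk hr] with j hj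
      exact ((hσ.abstractorInv j).heard_mem k n r hj).resolve_right (hnot j)
  have hown : ∀ᶠ j in atTop, ∀ r ∈ roots (x n), r ≤ a → r ∈ (σ j).found n := by
    obtain ⟨q, hq, haq⟩ := (hroots n).exists_root_gt a
    filter_upwards [hσ.eventually_found hroots hq] with j hj r hr hra
    exact (hσ.abstractorInv j).found_down n q hj r hr (hra.trans haq.le)
  have hother : ∀ᶠ j in atTop, ∀ k, k ≠ n → ∃ r ∈ (σ j).heard n k, a ≤ r + ε := by
    rw [eventually_all]
    intro k
    rcases eq_or_ne k n with hk | hk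
    · exact Eventually.of_forall fun j h => absurd hk h
    · obtain ⟨q, hq, haq⟩ := exists_isRightRoot_gt (hx k) (hroots k) a
      filter_upwards [hσ.eventually_heard hroots hk hq] with j hj _
      exact ⟨q, hj, haq.le.trans le_self_add⟩
  obtain ⟨I, hI⟩ := eventually_atTop.1 (hbuf.and (hown.and hother))
  refine false_of_frequently_ne (f := fun i => (stream ε x n ∩ Iic a) \ (σ i).buffer n) (I := I)
    (stream_inter_Iic_finite hroots n a).finite_subsets (fun j hj => ?_)
    (fun j _ => sdiff_subset) fun i hi => ?_
  · obtain ⟨b, hb⟩ := hσ.step j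
    rintro s ⟨hs, hs'⟩
    refine ⟨hs, fun h => hs' ?_⟩
    exact (hσ.abstractorInv j).buffer_subset hb (hI j hj).2.1 (hI j hj).2.2 h hs.2
  · obtain ⟨j, hij, hj⟩ := hσ.exists_step (a := .forward n) (i := i) fun j hij => by
      obtain ⟨h1, h2, h3⟩ := hI j (hi.trans hij)
      obtain ⟨s, hs⟩ := exists_isLeast_of_inter_Iic_finite (S := (σ j).buffer n)
        (fun T => (stream_inter_Iic_finite hroots n T).subset
          (inter_subset_inter_left _ ((hσ.abstractorInv j).buffer_sub n))) ⟨a, h1⟩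
      have hsa : s ≤ a := hs.2 h1
      refine ⟨_, Step.forward _ n s hs (fun r hr hrs => h2 r hr (hrs.trans hsa)) fun k hk => ?_⟩
      obtain ⟨r, hr, har⟩ := h3 k hk
      exact ⟨r, hr, hsa.trans har⟩
    refine ⟨j, hij, ?_⟩
    have hsub := (hσ.abstractorInv j).buffer_sub n
    have ha' := (hI j (hi.trans hij)).1
    generalize σ (j + 1) = st' at hj
    cases hj with
    | forward _ _ s hs _ _ =>
      intro h
      have hs' : s ∈ (stream ε x n ∩ Iic a) \ (σ j).buffer n := by
        rw [h]
        exact ⟨⟨hsub hs.1, hs.2 ha'⟩, by simp⟩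
      exact hs'.2 hs.1

lemma IsRun.eventually_exists_recv_gt (hσ : IsRun ε x σ) (hx : ∀ n, IsOutputSignal (x n))
    (hroots : ∀ n, StarvationFreeNonZeno (x n)) (n : Fin N) (T : ℝ≥0) :
    ∀ᶠ j in atTop, ∃ t ∈ (σ j).recv n, T < t := by
  obtain ⟨r, hr, hT⟩ := (hroots n).exists_root_gt T
  filter_upwards [hσ.eventually_recv hx hroots (Or.inr (Or.inl hr))] with j hj
  exact ⟨r, hj, hT⟩

/-! ### Progress of the tokens -/

lemma exists_assess (ε : ℝ≥0) (x : Fin N → ℝ≥0 → ℝ) (c : Fin N → ℝ≥0) :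
    ∃ tgt, Assess ε x c tgt := by
  by_cases hc : Consistent ε c
  · by_cases hsat : ∀ m, DSat (x m) (c m)
    · exact ⟨.home, hc, hsat⟩
    · push Not at hsat
      obtain ⟨m, hm⟩ := hsat
      exact ⟨.next m (c m), hc, hm, rfl⟩
  · unfold Consistent at hc
    push Not at hc
    obtain ⟨m, hm⟩ := hc
    exact ⟨.dep m (depend ε c m), hm, rfl⟩

/-- Every token moves infinitely often: its target becomes available, as the slicers receive later
and later events. -/
lemma IsRun.exists_move (hσ : IsRun ε x σ) (hx : ∀ n, IsOutputSignal (x n))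
    (hroots : ∀ n, StarvationFreeNonZeno (x n)) (n : Fin N) (i : ℕ) :
    ∃ j, i ≤ j ∧ Step ε x (.move n) (σ j) (σ (j + 1)) := by
  by_contra! hnot
  have hconst : ∀ j, i ≤ j → (σ j).token n = (σ i).token n := by
    intro j hij
    induction j, hij using Nat.le_induction with
    | base => rfl
    | succ j hij ih =>
      obtain ⟨a, ha⟩ := hσ.step j
      rcases ha.token_eq_or n with h1 | rfl
      · exact h1.trans ih
      · exact absurd ha (hnot j hij)
  have henabled : ∀ᶠ j in atTop, ∃ m s ev, Arrives (σ j) n m s ev := by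
    cases htgt : ((σ i).token n).target with
    | home =>
      filter_upwards [hσ.eventually_exists_recv_gt hx hroots n ((σ i).token n).event,
        eventually_ge_atTop i] with j ⟨t, ht, hlt⟩ hj
      obtain ⟨s, hs⟩ := exists_isLeast_of_inter_Iic_finite
        (S := {t ∈ (σ j).recv n | ((σ i).token n).event < t})
        (fun T => (stream_inter_Iic_finite hroots n T).subset (inter_subset_inter_left _
          ((sep_subset _ _).trans ((hσ.abstractorInv j).recv_sub n)))) ⟨t, ht, hlt⟩
      refine ⟨n, s, s, ?_⟩
      simp only [Arrives, hconst j hj, htgt]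
      exact ⟨trivial, hs, trivial⟩
    | dep m s =>
      filter_upwards [hσ.eventually_exists_recv_gt hx hroots m s, eventually_ge_atTop i]
        with j ht hj
      refine ⟨m, s, ((σ i).token n).event, ?_⟩
      simp only [Arrives, hconst j hj, htgt]
      exact ⟨trivial, trivial, trivial, Or.inr ht⟩
    | next m s' =>
      filter_upwards [hσ.eventually_exists_recv_gt hx hroots m s', eventually_ge_atTop i]
        with j ⟨t, ht, hlt⟩ hj
      have hT := hσ.tokenInv j
      obtain ⟨s, hs⟩ := exists_isLeast_of_inter_Iic_finite (S := {t ∈ (σ j).log m | s' < t})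
        (fun T => (hT.log_finite m).subset (inter_subset_left.trans (sep_subset _ _)))
        ⟨t, hT.recv_sub_log m ht, hlt⟩
      refine ⟨m, s, ((σ i).token n).event, ?_⟩
      simp only [Arrives, hconst j hj, htgt]
      exact ⟨trivial, hs, trivial⟩
  obtain ⟨J, hJ⟩ := eventually_atTop.1 henabled
  obtain ⟨j, hj, hmove⟩ := hσ.exists_step (a := .move n) (i := max i J) fun j hj => by
    obtain ⟨m, s, ev, harr⟩ := hJ j ((le_max_right _ _).trans hj)
    obtain ⟨tgt, htgt⟩ := exists_assess ε x ((σ j).newCut n m s)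
    exact ⟨_, Step.move _ n m s ev tgt harr htgt⟩
  exact hnot j ((le_max_left _ _).trans hj) hmove

/-- A move from an assessed target takes the token to a later event or enlarges its cut. -/
lemma Step.move_ne {st st' : State N} {n : Fin N} (h : Step ε x (.move n) st st')
    (hassess : Assess ε x (st.token n).cut (st.token n).target) :
    ((st.token n).event, (st.token n).cut) ≠ ((st'.token n).event, (st'.token n).cut) := by
  obtain ⟨m, s, ev, tgt, harr, -, h2⟩ := h.move_cases
  rw [h2]
  intro heq
  obtain ⟨h3, h4⟩ := Prod.mk.inj heq
  dsimp only at h3 h4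
  have hle : s ≤ (st.token n).cut m := h4 ▸ st.le_newCut_self n m s
  rcases harr.cases with ⟨-, -, hs, rfl⟩ | ⟨htgt, -, -⟩ | ⟨s', htgt, hs, -⟩
  · exact hs.1.2.ne h3
  · rw [htgt] at hassess
    obtain ⟨h5, rfl⟩ := hassess
    exact h5.not_ge hle
  · rw [htgt] at hassess
    obtain ⟨-, -, rfl⟩ := hassess
    exact (show (st.token n).cut m < s from hs.1.2).not_ge hle

lemma IsRun.exists_ne (hσ : IsRun ε x σ) (hx : ∀ n, IsOutputSignal (x n))
    (hroots : ∀ n, StarvationFreeNonZeno (x n)) (n : Fin N) (i : ℕ) :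
    ∃ j, i ≤ j ∧ (((σ j).token n).event, ((σ j).token n).cut) ≠
      (((σ (j + 1)).token n).event, ((σ (j + 1)).token n).cut) := by
  obtain ⟨j₀, hj₀, hmove⟩ := hσ.exists_move hx hroots n i
  -- The initial target is the only one that need not come from an assessment; the first move
  -- replaces it.
  have hassess : ∀ j, j₀ + 1 ≤ j → Assess ε x ((σ j).token n).cut ((σ j).token n).target := by
    intro j hj
    induction j, hj using Nat.le_induction with
    | base =>
      obtain ⟨m, s, ev, tgt, -, htgt, h2⟩ := hmove.move_cases
      rw [h2]
      exact htgt
    | succ j hj ih =>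
      obtain ⟨a, ha⟩ := hσ.step j
      rcases ha.token_eq_or n with h1 | rfl
      · rw [h1]
        exact ih
      · obtain ⟨m, s, ev, tgt, -, htgt, h2⟩ := ha.move_cases
        rw [h2]
        exact htgt
  obtain ⟨j, hj, hmove'⟩ := hσ.exists_move hx hroots n (j₀ + 1)
  exact ⟨j, hj₀.trans (j₀.le_succ.trans hj), hmove'.move_ne (hassess j hj)⟩

/-- The times that arise from those in `U` by going back any number of clock skews. -/
def backshifts (ε : ℝ≥0) (U : Set ℝ≥0) : Set ℝ≥0 :=
  {v | ∃ u ∈ U, ∃ k : ℕ, v = u - k * ε}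

lemma subset_backshifts (U : Set ℝ≥0) : U ⊆ backshifts ε U :=
  fun u hu => ⟨u, hu, 0, by simp⟩

lemma sub_mem_backshifts {U : Set ℝ≥0} {v : ℝ≥0} (hv : v ∈ backshifts ε U) :
    v - ε ∈ backshifts ε U := by
  obtain ⟨u, hu, k, rfl⟩ := hv
  exact ⟨u, hu, k + 1, by rw [tsub_tsub]; push_cast; ring_nf⟩

lemma backshifts_finite (hε : 0 < ε) {U : Set ℝ≥0} (hU : U.Finite) :
    (backshifts ε U).Finite := by
  refine ((finite_singleton (0 : ℝ≥0)).union (hU.biUnion fun u _ =>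
    (finite_Iic ⌈u / ε⌉₊).image fun k : ℕ => u - k * ε)).subset ?_
  rintro v ⟨u, hu, k, rfl⟩
  rcases le_total k ⌈u / ε⌉₊ with hk | hk
  · exact Or.inr (mem_biUnion hu ⟨k, hk, rfl⟩)
  · refine Or.inl (tsub_eq_zero_of_le ?_)
    rw [← div_le_iff₀ hε]
    exact (Nat.le_ceil _).trans (by exact_mod_cast hk)

/-- One step of the log below `T`. An event in it that is new is received from the abstractor or
created by a token whose cut is bounded by `T`; in the latter case it is a clock skew earlier than
some stored event up to `T`. -/
lemma Step.log_subset_backshifts {st st' : State N} {a : Action N} (hst : Step ε x a st st')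
    (hA : AbstractorInv ε x st) (hT : TokenInv ε x st) {U : Set ℝ≥0} {T : ℝ≥0}
    (hU : ∀ m, stream ε x m ∩ Iic T ⊆ U)
    (htok : ∀ n, (∀ m, (st.token n).cut m ≤ T) ∨ ∃ m, T + ε < (st.token n).cut m)
    (hlog : ∀ m, st.log m ∩ Iic T ⊆ backshifts ε U) (m : Fin N) :
    st'.log m ∩ Iic T ⊆ backshifts ε U := by
  cases hst with
  | find _ k r hr => exact hlog m
  | hear _ k j r l hl => exact hlog m
  | forward _ k s hs hown hother =>
    rintro t ⟨ht, htT⟩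
    change t ∈ Function.update st.log k (insert s (st.log k)) m at ht
    rcases eq_or_ne m k with rfl | hk
    · rw [Function.update_self] at ht
      rcases ht with rfl | ht
      · exact subset_backshifts U (hU m ⟨hA.buffer_sub m hs.1, htT⟩)
      · exact hlog m ⟨ht, htT⟩
    · rw [Function.update_of_ne hk] at ht
      exact hlog m ⟨ht, htT⟩
  | move _ n k s ev tgt harr htgt =>
    rintro t ⟨ht, htT⟩
    change t ∈ Function.update st.log k (insert s (st.log k)) m at ht
    rcases eq_or_ne m k with rfl | hk
    swap
    · rw [Function.update_of_ne hk] at ht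
      exact hlog m ⟨ht, htT⟩
    rw [Function.update_self] at ht
    rcases ht with rfl | ht
    swap
    · exact hlog m ⟨ht, htT⟩
    rcases harr.cases with ⟨-, rfl, hs, -⟩ | ⟨htgt', -, -⟩ | ⟨s', -, hs, -⟩
    · exact hlog m ⟨hT.recv_sub_log m hs.1.1, htT⟩
    · have hassess := hT.assess n
      rw [htgt'] at hassess
      rcases hassess with ⟨h1, h2⟩ | h0
      · rcases htok n with hb | ⟨j, hj⟩
        · obtain ⟨j, hj⟩ := exists_depend_eq h1
          rw [h2, hj]
          exact sub_mem_backshifts (hlog j ⟨hT.cut_mem n j, hb j⟩)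
        · have h3 : T < t := by
            rw [h2]
            exact (lt_tsub_iff_right.2 hj).trans_le (tsub_le_depend _ j m)
          exact absurd (mem_Iic.1 htT) h3.not_ge
      · have h3 : t = 0 := by injection h0
        rw [h3]
        exact hlog m ⟨hT.recv_sub_log m (hA.zero_mem m), mem_Iic.2 zero_le⟩
    · exact hlog m ⟨hs.1.1, htT⟩

/-- The cuts of every token are unbounded. If those of some tokens were bounded, let `T` bound all
of them. As soon as the other tokens are beyond `T + ε`, new events up to `T` are only received or
created by bounded tokens, so that they lie in a finite set; but the bounded tokens move infinitely
often and progress in this set each time. -/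
lemma IsRun.exists_lt_cut (hσ : IsRun ε x σ) (hε : 0 < ε) (hx : ∀ n, IsOutputSignal (x n))
    (hroots : ∀ n, StarvationFreeNonZeno (x n)) (n : Fin N) (T : ℝ≥0) :
    ∃ i m, T < ((σ i).token n).cut m := by
  by_contra! hbdd
  -- A common bound for all bounded tokens.
  obtain ⟨T, hT, hTall⟩ : ∃ T : ℝ≥0, (∀ i m, ((σ i).token n).cut m ≤ T) ∧
      ∀ k, (∀ i m, ((σ i).token k).cut m ≤ T) ∨ ∀ S : ℝ≥0, ∃ i m, S < ((σ i).token k).cut m := by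
    have hex : ∀ k, ∃ T : ℝ≥0, (∀ i m, ((σ i).token k).cut m ≤ T) ∨
        ∀ S : ℝ≥0, ∃ i m, S < ((σ i).token k).cut m := by
      intro k
      by_cases h : ∃ T : ℝ≥0, ∀ i m, ((σ i).token k).cut m ≤ T
      · obtain ⟨T, hT⟩ := h
        exact ⟨T, Or.inl hT⟩
      · push Not at h
        exact ⟨0, Or.inr h⟩
    choose B hB using hex
    refine ⟨T ⊔ Finset.univ.sup B, fun i m => (hbdd i m).trans le_sup_left, fun k => ?_⟩
    exact (hB k).imp_left fun h i m =>
      (h i m).trans ((Finset.le_sup (Finset.mem_univ k)).trans le_sup_right)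
  have htok : ∀ᶠ i in atTop, ∀ k, (∀ m, ((σ i).token k).cut m ≤ T) ∨
      ∃ m, T + ε < ((σ i).token k).cut m := by
    rw [eventually_all]
    intro k
    rcases hTall k with h | h
    · exact Eventually.of_forall fun i => Or.inl (h i)
    · obtain ⟨i, m, him⟩ := h (T + ε)
      filter_upwards [eventually_ge_atTop i] with j hj
      exact Or.inr ⟨m, him.trans_le (hσ.cut_mono k hj m)⟩
  obtain ⟨I, hI⟩ := eventually_atTop.1 htok
  set U : Set ℝ≥0 := (⋃ m, (σ I).log m) ∪ ⋃ m, stream ε x m ∩ Iic T with hU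
  have hUfin : U.Finite := (finite_iUnion (hσ.tokenInv I).log_finite).union
    (finite_iUnion fun m => stream_inter_Iic_finite hroots m T)
  have hlog : ∀ j, I ≤ j → ∀ m, (σ j).log m ∩ Iic T ⊆ backshifts ε U := by
    intro j hj
    induction j, hj using Nat.le_induction with
    | base => exact fun m t ht => subset_backshifts U (Or.inl (mem_iUnion.2 ⟨m, ht.1⟩))
    | succ j hj ih =>
      obtain ⟨a, ha⟩ := hσ.step j
      exact ha.log_subset_backshifts (hσ.abstractorInv j) (hσ.tokenInv j)
        (fun m t ht => Or.inr (mem_iUnion.2 ⟨m, ht⟩)) (hI j hj) ih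
  have hfin := backshifts_finite hε hUfin
  refine false_of_frequently_ne
    (f := fun j => (((σ j).token n).event, ((σ j).token n).cut)) (I := I)
    (hfin.prod (Finite.pi' fun _ : Fin N => hfin))
    (fun j _ => Prod.mk_le_mk.2 ⟨hσ.event_mono n j.le_succ, hσ.cut_mono n j.le_succ⟩) (fun j hj => ⟨?_, ?_⟩)
    fun i _ => hσ.exists_ne hx hroots n i
  · have h := hσ.tokenInv j
    exact hlog j hj n ⟨h.recv_sub_log n (h.event_mem n), (h.event_le n).trans (hT j n)⟩
  · exact fun m => hlog j hj m ⟨(hσ.tokenInv j).cut_mem n m, hT j m⟩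

/-! ### The returned cuts -/

/-- For every satisfying consistent frontier, the token of an agent whose entry belongs to the
stream outputs a cut below the frontier that agrees with it there. -/
lemma IsRun.exists_out (hσ : IsRun ε x σ) (hε : 0 < ε) (hx : ∀ n, IsOutputSignal (x n))
    (hroots : ∀ n, StarvationFreeNonZeno (x n)) {c : Fin N → ℝ≥0} (hc : Consistent ε c)
    (hsat : ∀ m, DSat (x m) (c m)) {n : Fin N} (hn : c n ∈ stream ε x n) :
    ∃ i, ∃ d ∈ (σ i).out, d ≤ c ∧ c n ≤ d n := by
  obtain ⟨i, m, him⟩ := hσ.exists_lt_cut hε hx hroots n (Finset.univ.sup c)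
  have hg := hσ.guarded hx hc hsat i
  refine ⟨i, hg.exists_out n hn ?_⟩
  by_contra! h
  exact him.not_ge ((hg.cut_le n h m).trans (Finset.le_sup (Finset.mem_univ m)))

/-- A satisfying consistent frontier is returned if each of its entries is in the stream or forced
by such an entry: it is the join of the cuts that the tokens output for these entries. -/
lemma IsRun.exists_mem_returned (hσ : IsRun ε x σ) (hN : 0 < N) (hε : 0 < ε)
    (hx : ∀ n, IsOutputSignal (x n)) (hroots : ∀ n, StarvationFreeNonZeno (x n))
    {c : Fin N → ℝ≥0} (hc : Consistent ε c) (hsat : ∀ m, DSat (x m) (c m))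
    (hstream : ∀ n, c n ∈ stream ε x n ∨ ∃ k, c k ∈ stream ε x k ∧ c n ≤ c k - ε) :
    ∃ j, c ∈ (σ j).returned := by
  have hex : ∀ n, ∃ i, ∃ d ∈ (σ i).out, d ≤ c ∧ c n ≤ d n := by
    intro n
    rcases hstream n with hn | ⟨k, hk, hnk⟩
    · exact hσ.exists_out hε hx hroots hc hsat hn
    · obtain ⟨i, d, hd, hdc, hkd⟩ := hσ.exists_out hε hx hroots hc hsat hk
      refine ⟨i, d, hd, hdc, hnk.trans (tsub_le_iff_right.2 (hkd.trans ?_))⟩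
      exact consistent_iff.1 ((hσ.tokenInv i).out_sat d hd).2.1 k n
  choose i d hd hdc hcd using hex
  have hne : (Finset.univ : Finset (Fin N)).Nonempty := ⟨⟨0, hN⟩, Finset.mem_univ _⟩
  have hjoin : c = Finset.univ.sup' hne d := by
    refine le_antisymm (fun n => (hcd n).trans ?_) (Finset.sup'_le hne d fun n _ => hdc n)
    exact Finset.le_sup' d (Finset.mem_univ n) n
  refine ⟨Finset.univ.sup i, ?_⟩
  rw [hjoin]
  exact supClosed_supClosure.finsetSup'_mem hne fun n _ =>
    subset_supClosure (hσ.out_mono (Finset.le_sup (Finset.mem_univ n)) (hd n))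

lemma IsDiscreteSatcut.sup {st : State N} {c d : Fin N → ℝ≥0} (hc : IsDiscreteSatcut ε x st c)
    (hd : IsDiscreteSatcut ε x st d) : IsDiscreteSatcut ε x st (c ⊔ d) := by
  refine ⟨fun m => ?_, hc.2.1.sup hd.2.1, fun m => ?_⟩ <;>
    rw [Pi.sup_apply] <;> rcases le_total (c m) (d m) with h | h
  · exact (sup_eq_right.2 h).symm ▸ hd.1 m
  · exact (sup_eq_left.2 h).symm ▸ hc.1 m
  · exact (sup_eq_right.2 h).symm ▸ hd.2.2 m
  · exact (sup_eq_left.2 h).symm ▸ hc.2.2 m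

lemma IsRun.isDiscreteSatcut_of_mem_returned (hσ : IsRun ε x σ) {i : ℕ} {c : Fin N → ℝ≥0}
    (hc : c ∈ (σ i).returned) : IsDiscreteSatcut ε x (σ i) c :=
  supClosure_min (t := {c | IsDiscreteSatcut ε x (σ i) c}) (hσ.tokenInv i).out_sat
    (fun _ ha _ hb => IsDiscreteSatcut.sup ha hb) hc

/-- The frontier of a leftmost satcut consists of left roots, initial events and events forced by
these left roots. -/
lemma IsRun.exists_mem_returned_of_isLeftmostSatcut (hσ : IsRun ε x σ) (hN : 0 < N) (hε : 0 < ε)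
    (hx : ∀ n, IsOutputSignal (x n)) (hroots : ∀ n, StarvationFreeNonZeno (x n))
    {C : Set (Event N)} (hC : IsLeftmostSatcut ε x C) : ∃ j, front C ∈ (σ j).returned := by
  refine hσ.exists_mem_returned hN hε hx hroots hC.1.1.consistent_front
    (fun m => Or.inl (hC.1.2 m)) fun n => ?_
  rcases hC.front_cases hN hε hx n with h | h | ⟨k, hk, h⟩
  · exact Or.inl (Or.inl h)
  · exact Or.inl (Or.inr (Or.inl (Or.inl h)))
  · exact Or.inr ⟨k, Or.inr (Or.inl (Or.inl hk)), le_tsub_of_add_le_right h.ge⟩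

/-- The frontier of a rightmost cut consists of right roots and events blocked by them if the cut is
satisfying, and of one right root and events forced by it otherwise. -/
lemma IsRun.exists_mem_returned_of_isRightmostCut (hσ : IsRun ε x σ) (hN : 0 < N) (hε : 0 < ε)
    (hx : ∀ n, IsOutputSignal (x n)) (hroots : ∀ n, StarvationFreeNonZeno (x n))
    {C : Set (Event N)} (hC : IsRightmostCut ε x C) : ∃ j, front C ∈ (σ j).returned := by
  refine hσ.exists_mem_returned hN hε hx hroots hC.1.consistent_front (hC.dSat hN hx) fun n => ?_
  by_cases hsat : ∀ m, 0 ≤ x m (front C m)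
  · rcases hC.front_cases_of_sat hN hε hx hsat n with h | ⟨k, hkn, hk, h⟩
    · exact Or.inl (Or.inr (Or.inl (Or.inr h)))
    · exact Or.inl (Or.inr (Or.inr ⟨k, hkn, _, hk, h⟩))
  · push Not at hsat
    obtain ⟨m, hm⟩ := hsat
    have hroot : front C m ∈ stream ε x m :=
      Or.inr (Or.inl (Or.inr ((hC.dSat hN hx m).resolve_left hm.not_ge).1))
    rcases hC.front_cases_of_neg hN hm n with rfl | h
    · exact Or.inl hroot
    · exact Or.inr ⟨m, hroot, h.le⟩

end Run

end PredDetect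

theorem mainTheorem7 (N : ℕ) (hN : 0 < N) (ε : NNReal) (hε : 0 < ε)
    (x : Fin N → NNReal → ℝ)
    (hx : ∀ n, PredDetect.IsOutputSignal (x n))
    (hroots : ∀ n, PredDetect.StarvationFreeNonZeno (x n))
    (σ : ℕ → PredDetect.State N) (hσ : PredDetect.IsRun ε x σ) :
    (∀ i, ∀ c ∈ (σ i).returned, PredDetect.IsDiscreteSatcut ε x (σ i) c) ∧
    (∀ i c, PredDetect.IsDiscreteSatcut ε x (σ i) c → (∀ m, c m ∈ (σ i).recv m) →
      ∃ j, c ∈ (σ j).returned) ∧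
    (∀ C, PredDetect.IsExtremalCut ε x C → ∃ j, PredDetect.front C ∈ (σ j).returned) := by
  refine ⟨fun i c hc => hσ.isDiscreteSatcut_of_mem_returned hc, fun i c hc hrecv => ?_,
    fun C hC => ?_⟩
  · exact hσ.exists_mem_returned hN hε hx hroots hc.2.1 hc.2.2 fun n =>
      Or.inl ((hσ.abstractorInv i).recv_sub n (hrecv n))
  · rcases hC with hC | hC
    · exact hσ.exists_mem_returned_of_isLeftmostSatcut hN hε hx hroots hC
    · exact hσ.exists_mem_returned_of_isRightmostCut hN hε hx hroots hC
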